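/- Consider the two-dimensional incompressible Euler equations in the channel $\{-1<y<1\}$ with impermeable walls. Let $T>0$ and $s>\frac32$. Then there is $\varepsilon_0>0$ such that every shear flow $(U(y),0)$ on $(-1,1)$ with $$\|U'-1\|_{H^{s}(-1,1)}\le\varepsilon_0$$ is linearly stable to perturbations of $x$-period $T$. Here $H^s(-1,1)$ is the (fractional) Sobolev space of restrictions to $(-1,1)$ of functions in $H^s(\mathbb R)$, with the quotient norm. Linear stability means that the Euler equations linearized at $(U,0)$ on $S_T\times(-1,1)$, $S_T$ being the circle of length $T$, have no unstable eigenvalue: there are no $\lambda\in\mathbb C$ with $\operatorname{Re}\lambda>0$ and nonzero complex-valued velocity field $(u,v)\in L^2(S_T\times(-1,1))$ such that, in the weak sense and for some pressure $P$ of period $T$ in $x$, $$\lambda u+U\,\partial_x u+U'v=-\partial_x P,\qquad \lambda v+U\,\partial_x v=-\partial_y P,\qquad \partial_x u+\partial_y v=0,\qquad v=0\ \text{ on } y=\pm1 .$$ -/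

import Mathlib

open MeasureTheory Set
open scoped ENNReal ContDiff FourierTransform

noncomputable section

namespace ShearFlow

/-- The norm of `F ∈ L²(ℝ)` in the Sobolev space `H^s(ℝ)`, `s ≥ 0`: the `L²` norm of
`(1 + |2πξ|²)^{s/2} F̂(ξ)`, with value `∞` if `F ∉ H^s(ℝ)`.  The Fourier transform is
`F̂(ξ) = ∫ exp(-2πixξ) F(x) dx`, so that `2πξ` is the frequency. -/
def sobolevNormReal (s : ℝ) (F : Lp ℂ 2 (volume : Measure ℝ)) : ℝ≥0∞ :=
  eLpNorm (fun ξ : ℝ => (((1 + (2 * Real.pi * ξ) ^ 2) ^ (s / 2) : ℝ) : ℂ) *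
    (𝓕 F : Lp ℂ 2 (volume : Measure ℝ)) ξ) 2 volume

/-- The norm of `f` in `H^s(-1,1)`, `s ≥ 0`, the space of restrictions to `(-1,1)` of elements
of `H^s(ℝ)`, with the quotient norm: the infimum of the `H^s(ℝ)` norms of all extensions of `f`.
It is `∞` if `f ∉ H^s(-1,1)`. -/
def sobolevNorm (s : ℝ) (f : ℝ → ℝ) : ℝ≥0∞ :=
  ⨅ (F : Lp ℂ 2 (volume : Measure ℝ))
    (_ : ∀ᵐ y ∂(volume.restrict (Ioo (-1 : ℝ) 1)), F y = (f y : ℂ)), sobolevNormReal s F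

/-- A period cell of the channel `Ω_T = S_T × (-1,1)`, where `S_T` is the circle of length `T`. -/
def cell (T : ℝ) : Set (ℝ × ℝ) := Ioc 0 T ×ˢ Ioo (-1) 1

/-- The function `f(x,y)` has period `T` in `x`. -/
def XPeriodic (T : ℝ) (f : ℝ × ℝ → ℂ) : Prop := ∀ x y : ℝ, f (x + T, y) = f (x, y)

/-- The partial derivative in `x`. -/
def dx (f : ℝ × ℝ → ℂ) (p : ℝ × ℝ) : ℂ := fderiv ℝ f p (1, 0)

/-- The partial derivative in `y`. -/
def dy (f : ℝ × ℝ → ℂ) (p : ℝ × ℝ) : ℂ := fderiv ℝ f p (0, 1)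

/-- `(u, v)` is a square integrable velocity field on `Ω_T` that is divergence free and
tangent to the walls, i.e. `u_x + v_y = 0` and `v = 0` on `y = ±1`, both in the weak sense: it is
`L²`-orthogonal to the gradients of all functions that are smooth on the closed channel
(nothing is required of `φ` at the walls). -/
structure IsVelocity (T : ℝ) (u v : ℝ × ℝ → ℂ) : Prop where
  periodic_u : XPeriodic T u
  periodic_v : XPeriodic T v
  memLp_u : MemLp u 2 (volume.restrict (cell T))
  memLp_v : MemLp v 2 (volume.restrict (cell T))
  div_free : ∀ φ : ℝ × ℝ → ℂ, ContDiff ℝ ∞ φ → XPeriodic T φ →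
    ∫ p in cell T, (u p * dx φ p + v p * dy φ p) = 0

/-- `(a, b)` is a smooth divergence free test field on the closed channel, tangent to the walls. -/
structure IsTestField (T : ℝ) (a b : ℝ × ℝ → ℂ) : Prop where
  smooth_a : ContDiff ℝ ∞ a
  smooth_b : ContDiff ℝ ∞ b
  periodic_a : XPeriodic T a
  periodic_b : XPeriodic T b
  div_free : ∀ p, dx a p + dy b p = 0
  tangent : ∀ x : ℝ, b (x, -1) = 0 ∧ b (x, 1) = 0

/-- `(u, v)` is a weak solution of
`lam u + U u_x + U' v = - P_x`, `lam v + U v_x = - P_y` on `Ω_T`, for some pressure `P`;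
that is, `exp(lam t) (u, v)` solves the Euler equation linearized at the shear flow `(U(y), 0)`.
The pressure, which has period `T` in `x`, is eliminated by testing with divergence free fields. -/
def SolvesEigenvalueEquation (T : ℝ) (U : ℝ → ℝ) (lam : ℂ) (u v : ℝ × ℝ → ℂ) : Prop :=
  ∀ a b : ℝ × ℝ → ℂ, IsTestField T a b →
    ∫ p in cell T, (lam * (u p * a p + v p * b p)
      - (U p.2 : ℂ) * (u p * dx a p + v p * dx b p)
      + ((deriv U p.2 : ℝ) : ℂ) * (v p * a p)) = 0

/-- `lam` is an eigenvalue of the Euler equation linearized at `(U(y), 0)`, on the space of square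
integrable velocity fields with `x`-period `T`. -/
def IsEigenvalue (T : ℝ) (U : ℝ → ℝ) (lam : ℂ) : Prop :=
  ∃ u v : ℝ × ℝ → ℂ, IsVelocity T u v ∧
    ¬ (u =ᵐ[volume.restrict (cell T)] 0 ∧ v =ᵐ[volume.restrict (cell T)] 0) ∧
    SolvesEigenvalueEquation T U lam u v

/-- The shear flow `(U(y), 0)` is linearly stable to perturbations of `x`-period `T`: the
linearized Euler equation has no unstable eigenvalue. -/
def IsLinearlyStable (T : ℝ) (U : ℝ → ℝ) : Prop :=
  ∀ lam : ℂ, IsEigenvalue T U lam → lam.re ≤ 0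

end ShearFlow

end

/-! For `s > 3/2` the Sobolev embedding makes `U` close to Couette flow in `C^{2,α}`, for some `0 <
α ≤ 1/2`, and this suffices for stability. The mode of an eigenfunction with wave number `k ≠ 0`
reduces to the Rayleigh equation `V'' = k² V + ik U'' V / (λ + ikU)` with `V(±1) = 0`. Multiplying
by the conjugate of `V`, integrating and taking real parts gives `∫|V'|² + k² ∫|V|² + ∫ U'' |V|² Re
(ik / (λ + ikU)) = 0`.

The last integral is nearly singular when `Re λ` is small, so absolute values are useless. Its
kernel is `Re 1/(U - c + ie)`, and `U'` times this kernel is the derivative of `log |U - c + ie|`.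
The density `U''|V|²/U'` is Hölder, of size `δ ∫|V'|²`, and vanishes at the walls. Subtracting its
value at the singular point leaves an integrable singularity `|y - p|^(α-1)`; the subtracted part is
a logarithm, tamed near a wall by the vanishing of the density (`abs_integral_reCauchyKernel_le`).
The last integral is thus at most `Cδ ∫|V'|²`, uniformly in `λ` and `k`, and small `δ` forces `V =
0` (`rayleigh_eq_zero`).

An `L²` weak eigenfunction is first shown to be regular mode by mode (`mode_eq_zero`). The mode `k =
0` is treated directly, and Parseval in `x` concludes. -/

namespace ShearFlow

/-! ### Sobolev embedding through the Fourier transform -/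

section SobolevEmbedding

/-- Cauchy–Schwarz: `L²` control of `(1 + |2πξ|²)^{s/2} h` gives `L¹` control of
`(1 + |2πξ|²)^{β/2} h` when `s - β > 1/2`. -/
lemma eLpNorm_one_weight_le {s β : ℝ} (hsβ : 1 < 2 * (s - β)) :
    ∃ C : ℝ, 0 < C ∧ ∀ (h : ℝ → ℂ) (N : ℝ), AEStronglyMeasurable h volume → 0 ≤ N →
      eLpNorm (fun ξ : ℝ => (((1 + (2 * Real.pi * ξ) ^ 2) ^ (s / 2) : ℝ) : ℂ) * h ξ) 2 volume
        ≤ ENNReal.ofReal N →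
      Integrable (fun ξ : ℝ => (1 + (2 * Real.pi * ξ) ^ 2) ^ (β / 2) * ‖h ξ‖) ∧
      ∫ ξ : ℝ, (1 + (2 * Real.pi * ξ) ^ 2) ^ (β / 2) * ‖h ξ‖ ≤ C * N := by
  set w : ℝ → ℝ := fun ξ => 1 + (2 * Real.pi * ξ) ^ 2 with hw
  have hwpos : ∀ ξ, 0 < w ξ := fun ξ => by positivity
  have hwc : ∀ r : ℝ, Continuous fun ξ => (w ξ) ^ r := fun r =>
    Continuous.rpow_const (by fun_prop) fun ξ => Or.inl (hwpos ξ).ne'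
  -- The other Cauchy–Schwarz factor in `w^(β/2) |h| = w^((β-s)/2) · |w^(s/2) h|`; it is square
  -- integrable exactly because `2(s - β) > 1`.
  have hφ : MemLp (fun ξ => (w ξ) ^ ((β - s) / 2)) 2 volume := by
    rw [memLp_two_iff_integrable_sq (hwc _).aestronglyMeasurable]
    have h1 : Integrable (fun x : ℝ => ((1 : ℝ) + ‖x‖ ^ 2) ^ (-(2 * (s - β)) / 2)) volume :=
      integrable_rpow_neg_one_add_norm_sq (by simpa using hsβ)
    have h2 := h1.comp_mul_left' (R := 2 * Real.pi) (by positivity)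
    refine h2.congr (Filter.Eventually.of_forall fun ξ => ?_)
    simp only [Real.norm_eq_abs, sq_abs]
    rw [← Real.rpow_mul_natCast (hwpos ξ).le]
    congr 1
    push_cast; ring
  refine ⟨(eLpNorm (fun ξ => (w ξ) ^ ((β - s) / 2)) 2 volume).toReal + 1, by positivity, ?_⟩
  intro h N hm hN hle
  set g : ℝ → ℂ := fun ξ : ℝ => (((w ξ) ^ (s / 2) : ℝ) : ℂ) * h ξ with hg
  have hgm : AEStronglyMeasurable g volume :=
    ((Complex.continuous_ofReal.comp (hwc _)).aestronglyMeasurable).mul hm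
  have hgL : MemLp g 2 volume := ⟨hgm, hle.trans_lt ENNReal.ofReal_lt_top⟩
  have hmul := eLpNorm_smul_le_mul_eLpNorm (p := 2) (q := 2) (r := 1) hgm
    (hwc ((β - s) / 2)).aestronglyMeasurable (μ := volume)
  have hint : Integrable ((fun ξ => (w ξ) ^ ((β - s) / 2)) • g) volume := by
    rw [← memLp_one_iff_integrable]
    exact hgL.smul hφ
  have hnorm : ∀ ξ, ‖((fun ξ => (w ξ) ^ ((β - s) / 2)) • g) ξ‖ = (w ξ) ^ (β / 2) * ‖h ξ‖ := by
    intro ξ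
    simp only [Pi.smul_apply', hg, norm_smul, norm_mul, Complex.norm_real, Real.norm_eq_abs,
      abs_of_pos (Real.rpow_pos_of_pos (hwpos ξ) _)]
    rw [← mul_assoc, ← Real.rpow_add (hwpos ξ)]
    congr 2; ring
  refine ⟨hint.norm.congr (Filter.Eventually.of_forall hnorm), ?_⟩
  rw [← integral_congr_ae (Filter.Eventually.of_forall hnorm),
    integral_norm_eq_lintegral_enorm hint.1, ← eLpNorm_one_eq_lintegral_enorm]
  calc (eLpNorm ((fun ξ => (w ξ) ^ ((β - s) / 2)) • g) 1 volume).toReal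
      ≤ (eLpNorm (fun ξ => (w ξ) ^ ((β - s) / 2)) 2 volume * ENNReal.ofReal N).toReal := by
        refine ENNReal.toReal_mono (ENNReal.mul_ne_top hφ.2.ne ENNReal.ofReal_ne_top) ?_
        exact hmul.trans (mul_le_mul_right hle _)
    _ = (eLpNorm (fun ξ => (w ξ) ^ ((β - s) / 2)) 2 volume).toReal * N := by
        rw [ENNReal.toReal_mul, ENNReal.toReal_ofReal hN]
    _ ≤ _ := by nlinarith

/-- Fourier inversion for an `L²` function whose Fourier transform is integrable. -/
lemma Lp_ae_eq_fourierInv (F : Lp ℂ 2 (volume : Measure ℝ))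
    (hF : Integrable (𝓕 F : Lp ℂ 2 (volume : Measure ℝ)) volume) :
    ∀ᵐ x, F x = 𝓕⁻ (fun ξ => (𝓕 F : Lp ℂ 2 (volume : Measure ℝ)) ξ) x := by
  set h : ℝ → ℂ := fun ξ => (𝓕 F : Lp ℂ 2 (volume : Measure ℝ)) ξ with hh
  have hcont : Continuous (𝓕⁻ h) :=
    VectorFourier.fourierIntegral_continuous (L := -innerₗ ℝ) Real.continuous_fourierChar
      (by simp only [LinearMap.neg_apply, innerₗ_apply_apply]; fun_prop) hF
  refine ae_eq_of_integral_contDiff_smul_eq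
    ((Lp.memLp F).locallyIntegrable (by norm_num)) hcont.locallyIntegrable ?_
  intro g g_smooth g_cpt
  have hg₁ : HasCompactSupport (Complex.ofRealCLM ∘ g) := g_cpt.comp_left rfl
  have hg₂ : ContDiff ℝ ∞ (Complex.ofRealCLM ∘ g) := by fun_prop
  set G := hg₁.toSchwartzMap hg₂ with hG
  have h1 : ∫ x, g x • F x = (F : TemperedDistribution ℝ ℂ) G := by
    simp [Lp.toTemperedDistribution_apply, hG]
  have h2 : (F : TemperedDistribution ℝ ℂ) G = ∫ x, (𝓕⁻ G) x • h x := by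
    have h3 : (F : TemperedDistribution ℝ ℂ) = 𝓕⁻ (𝓕 (F : TemperedDistribution ℝ ℂ)) :=
      (FourierTransform.fourierInv_fourier_eq _).symm
    rw [h3, Lp.fourier_toTemperedDistribution_eq, TemperedDistribution.fourierInv_apply,
      Lp.toTemperedDistribution_apply]
  rw [h1, h2, SchwartzMap.fourierInv_coe]
  -- The inverse transform is symmetric for the bilinear pairing, so it moves from the test function
  -- to `h`.
  have := VectorFourier.integral_fourierIntegral_smul_eq_flip (L := -innerₗ ℝ) (μ := volume)
    (ν := volume) (f := (G : ℝ → ℂ)) (g := h)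
    Real.continuous_fourierChar (by simp only [LinearMap.neg_apply, innerₗ_apply_apply]; fun_prop)
    G.integrable hF
  refine this.trans ?_
  refine integral_congr_ae (Filter.Eventually.of_forall fun x => ?_)
  have e : (-innerₗ ℝ).flip = -innerₗ ℝ := by
    ext; simp
  rw [e]
  simp only [hG]
  simp
  exact Or.inl rfl

/-- Interpolation between the Lipschitz bound `d` and the trivial bound `2`: use the first when `d ≤
1`, the second when `d ≥ 1`. -/
lemma norm_fourierChar_sub_le {α : ℝ} (h0 : 0 ≤ α) (h1 : α ≤ 1) (a b : ℝ) :
    ‖(Real.fourierChar a : ℂ) - Real.fourierChar b‖ ≤ 2 * (2 * Real.pi * |a - b|) ^ α := by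
  set d := 2 * Real.pi * |a - b| with hd
  have hd0 : 0 ≤ d := by positivity
  have e1 : (Real.fourierChar a : ℂ) - Real.fourierChar b
      = Real.fourierChar b * (Complex.exp (Complex.I * ((2 * Real.pi * (a - b) : ℝ) : ℂ)) - 1) := by
    rw [mul_sub, mul_one, Real.fourierChar_apply, Real.fourierChar_apply, ← Complex.exp_add]
    congr 2; push_cast; ring
  have e2 : ‖(Real.fourierChar a : ℂ) - Real.fourierChar b‖ ≤ d := by
    rw [e1, norm_mul, Circle.norm_coe, one_mul]
    refine Real.norm_exp_I_mul_ofReal_sub_one_le.trans (le_of_eq ?_)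
    rw [Real.norm_eq_abs, abs_mul, abs_of_pos (by positivity : 0 < 2 * Real.pi)]
  have e3 : ‖(Real.fourierChar a : ℂ) - Real.fourierChar b‖ ≤ 2 := by
    refine (norm_sub_le _ _).trans ?_
    rw [Circle.norm_coe, Circle.norm_coe]; norm_num
  rcases le_total d 1 with hd1 | hd1
  · have : d ≤ d ^ α := by
      conv_lhs => rw [← Real.rpow_one d]
      rcases hd0.eq_or_lt with h | h
      · rw [← h]; simp [Real.zero_rpow_nonneg]
      · exact Real.rpow_le_rpow_of_exponent_ge h hd1 h1
    linarith [Real.rpow_nonneg hd0 α]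
  · have : 1 ≤ d ^ α := Real.one_le_rpow hd1 h0
    linarith

lemma norm_fourier_sub_le {α : ℝ} (h0 : 0 ≤ α) (h1 : α ≤ 1) {m : ℝ → ℂ} (hm : Integrable m)
    (hm' : Integrable fun ξ : ℝ => (2 * Real.pi * |ξ|) ^ α * ‖m ξ‖) (x y : ℝ) :
    ‖𝓕 m x - 𝓕 m y‖ ≤ 2 * |x - y| ^ α * ∫ ξ : ℝ, (2 * Real.pi * |ξ|) ^ α * ‖m ξ‖ := by
  rw [Real.fourier_real_eq, Real.fourier_real_eq, ← integral_sub
    (by simpa [mul_comm] using (Real.fourierIntegral_convergent_iff (μ := volume) (f := m) x).2 hm)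
    (by simpa [mul_comm] using (Real.fourierIntegral_convergent_iff (μ := volume) (f := m) y).2 hm),
    ← integral_const_mul]
  refine norm_integral_le_of_norm_le (hm'.const_mul _) (Filter.Eventually.of_forall fun ξ => ?_)
  rw [Circle.smul_def, Circle.smul_def, ← sub_smul, norm_smul]
  refine (mul_le_mul_of_nonneg_right (norm_fourierChar_sub_le h0 h1 _ _)
    (norm_nonneg _)).trans (le_of_eq ?_)
  rw [show 2 * Real.pi * |-(ξ * x) - -(ξ * y)| = |x - y| * (2 * Real.pi * |ξ|) by
    rw [show -(ξ * x) - -(ξ * y) = -(ξ * (x - y)) by ring, abs_neg, abs_mul]; ring,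
    Real.mul_rpow (abs_nonneg _) (by positivity)]
  ring

/-- The embedding `H^s(-1,1) ⊂ C^{1,α}` for `0 < α < s - 3/2`. -/
lemma exists_hasDerivAt_holder_of_sobolevNorm_le {s α : ℝ} (hα : 0 < α) (hα1 : α ≤ 1)
    (hαs : α < s - 3 / 2) :
    ∃ C : ℝ, 0 < C ∧ ∀ (f : ℝ → ℝ) (ε : ℝ), 0 < ε → sobolevNorm s f ≤ ENNReal.ofReal ε →
      ∃ G G' : ℝ → ℝ, (∀ᵐ y ∂(volume.restrict (Ioo (-1 : ℝ) 1)), f y = G y) ∧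
        (∀ y, HasDerivAt G (G' y) y) ∧ (∀ y, |G y| ≤ C * ε) ∧ (∀ y, |G' y| ≤ C * ε) ∧
        ∀ x y, |G' x - G' y| ≤ C * ε * |x - y| ^ α := by
  -- The weight `β = 1 + α` pays for one derivative and a Hölder exponent `α`; `s - β > 1/2` is then
  -- the hypothesis on `α`.
  obtain ⟨C, hC, hCw⟩ := eLpNorm_one_weight_le (s := s) (β := 1 + α) (by linarith)
  refine ⟨4 * C, by positivity, fun f ε hε hf => ?_⟩
  -- The infimum over extensions need not be attained; doubling `ε` yields an actual extension.
  have hlt : sobolevNorm s f < ENNReal.ofReal (2 * ε) :=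
    hf.trans_lt ((ENNReal.ofReal_lt_ofReal_iff (by positivity)).2 (by linarith))
  obtain ⟨F, hF⟩ := iInf_lt_iff.1 hlt
  obtain ⟨hFf, hFN⟩ := iInf_lt_iff.1 hF
  set h : ℝ → ℂ := fun ξ => (𝓕 F : Lp ℂ 2 (volume : Measure ℝ)) ξ with hh
  have hhm : AEStronglyMeasurable h volume := Lp.aestronglyMeasurable _
  obtain ⟨hI, hIle⟩ := hCw h (2 * ε) hhm (by positivity) hFN.le
  set w : ℝ → ℝ := fun ξ => 1 + (2 * Real.pi * ξ) ^ 2 with hw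
  have hw1 : ∀ ξ, 1 ≤ w ξ := fun ξ => by simp only [hw]; nlinarith [sq_nonneg (2 * Real.pi * ξ)]
  -- The reflection turns the inverse transform of `h` into the Fourier transform of `k`, so the
  -- differentiation theorem for `𝓕` applies; `m` below is the density of the derivative.
  set k : ℝ → ℂ := fun ξ => h (-ξ) with hk
  have hkm : AEStronglyMeasurable k volume :=
    hhm.comp_quasiMeasurePreserving (Measure.measurePreserving_neg volume).quasiMeasurePreserving
  have hkI : Integrable (fun ξ => (w ξ) ^ ((1 + α) / 2) * ‖k ξ‖) := by
    simpa [hw, hk] using hI.comp_neg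
  have hkle : ∫ ξ, (w ξ) ^ ((1 + α) / 2) * ‖k ξ‖ ≤ C * (2 * ε) := by
    refine le_trans (le_of_eq ?_) hIle
    rw [← integral_neg_eq_self]
    simp [hw, hk]
  set a : ℝ → ℝ := fun ξ => 2 * Real.pi * |ξ| with ha
  have ha0 : ∀ ξ, 0 ≤ a ξ := fun ξ => by positivity
  have haw : ∀ ξ, ∀ β : ℝ, 0 ≤ β → β ≤ 1 + α → (a ξ) ^ β ≤ (w ξ) ^ ((1 + α) / 2) := by
    intro ξ β h0 h1
    have : (a ξ) ^ β = (a ξ ^ 2) ^ (β / 2) := by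
      rw [← Real.rpow_natCast_mul (ha0 ξ)]; congr 1; push_cast; ring
    rw [this]
    have e : a ξ ^ 2 ≤ w ξ := by
      simp only [ha, hw, mul_pow, sq_abs]; linarith
    exact (Real.rpow_le_rpow (by positivity) e (by positivity)).trans
      (Real.rpow_le_rpow_of_exponent_le (hw1 ξ) (by linarith))
  have hac : Continuous a := by fun_prop
  have haI : ∀ β : ℝ, 0 ≤ β → β ≤ 1 + α → Integrable (fun ξ => (a ξ) ^ β * ‖k ξ‖) ∧
      ∫ ξ, (a ξ) ^ β * ‖k ξ‖ ≤ C * (2 * ε) := by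
    intro β h0 h1
    have hI' : Integrable (fun ξ => (a ξ) ^ β * ‖k ξ‖) := by
      refine hkI.mono' ((hac.rpow_const fun _ => Or.inr h0).aestronglyMeasurable.mul hkm.norm)
        (Filter.Eventually.of_forall fun ξ => ?_)
      rw [Real.norm_of_nonneg (mul_nonneg (Real.rpow_nonneg (ha0 ξ) _) (norm_nonneg _))]
      exact mul_le_mul_of_nonneg_right (haw ξ β h0 h1) (norm_nonneg _)
    exact ⟨hI', (integral_mono hI' hkI fun ξ =>
      mul_le_mul_of_nonneg_right (haw ξ β h0 h1) (norm_nonneg _)).trans hkle⟩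
  have hk1 : Integrable k := by
    have := (haI 0 le_rfl (by linarith)).1
    simp only [Real.rpow_zero, one_mul] at this
    exact (integrable_norm_iff hkm).1 this
  have hk1le : ∫ ξ, ‖k ξ‖ ≤ C * (2 * ε) := by
    simpa using (haI 0 le_rfl (by linarith)).2
  set m : ℝ → ℂ := fun ξ => (-2 * Real.pi * Complex.I * ξ) • k ξ with hm
  have hmn : ∀ ξ, ‖m ξ‖ = a ξ * ‖k ξ‖ := by
    intro ξ
    simp [hm, ha, abs_of_pos Real.pi_pos]
  have hmI : Integrable m := by
    have hc : Continuous fun ξ : ℝ => (-2 * Real.pi * Complex.I * ξ : ℂ) := by fun_prop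
    refine (integrable_norm_iff (hc.aestronglyMeasurable.smul hkm)).1 ?_
    have := (haI 1 zero_le_one (by linarith)).1
    simp only [Real.rpow_one] at this
    exact this.congr (Filter.Eventually.of_forall fun ξ => (hmn ξ).symm)
  have hmle : ∫ ξ, ‖m ξ‖ ≤ C * (2 * ε) := by
    have := (haI 1 zero_le_one (by linarith)).2
    simp only [Real.rpow_one] at this
    simpa only [hmn] using this
  have hxk : Integrable (fun ξ : ℝ => ξ • k ξ) := by
    have := hmI.const_mul ((-2 * Real.pi * Complex.I)⁻¹)
    refine this.congr (Filter.Eventually.of_forall fun ξ => ?_)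
    have : (Real.pi : ℂ) ≠ 0 := by exact_mod_cast Real.pi_ne_zero
    simp only [hm, smul_eq_mul, Complex.real_smul]
    field_simp
  have hder : ∀ y, HasDerivAt (𝓕 k) (𝓕 m y) y := fun y => Real.hasDerivAt_fourier hk1 hxk y
  have hmα : (fun ξ : ℝ => (2 * Real.pi * |ξ|) ^ α * ‖m ξ‖) =
      fun ξ => (a ξ) ^ (1 + α) * ‖k ξ‖ := by
    funext ξ
    rw [hmn]
    rcases (ha0 ξ).eq_or_lt with h | h
    · simp [← h, Real.zero_rpow (by linarith : 1 + α ≠ 0)]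
    · rw [Real.rpow_add h, Real.rpow_one]; ring
  have hinv := Lp_ae_eq_fourierInv F (by
    have := hk1.comp_neg
    simpa [hk] using this)
  refine ⟨fun y => (𝓕 k y).re, fun y => (𝓕 m y).re, ?_, fun y => ?_, fun y => ?_, fun y => ?_,
    fun x y => ?_⟩
  · filter_upwards [hFf, ae_restrict_of_ae hinv] with y h1 h2
    rw [h1, Real.fourierInv_eq_fourier_comp_neg] at h2
    have := congrArg Complex.re h2
    simpa using this
  · exact Complex.reCLM.hasFDerivAt.comp_hasDerivAt y (hder y)
  · refine (Complex.abs_re_le_norm _).trans ((VectorFourier.norm_fourierIntegral_le_integral_norm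
      _ _ _ _ _).trans ?_)
    nlinarith [hk1le, mul_pos hC hε]
  · refine (Complex.abs_re_le_norm _).trans ((VectorFourier.norm_fourierIntegral_le_integral_norm
      _ _ _ _ _).trans ?_)
    nlinarith [hmle, mul_pos hC hε]
  · rw [← Complex.sub_re]
    refine (Complex.abs_re_le_norm _).trans ((norm_fourier_sub_le hα.le hα1 hmI
      (by rw [hmα]; exact (haI (1 + α) (by linarith) le_rfl).1) x y).trans ?_)
    rw [hmα]
    have := (haI (1 + α) (by linarith) le_rfl).2
    have h3 := Real.rpow_nonneg (abs_nonneg (x - y)) α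
    calc _ ≤ 2 * |x - y| ^ α * (C * (2 * ε)) := mul_le_mul_of_nonneg_left this (by positivity)
      _ = _ := by ring

end SobolevEmbedding

/-! ### Uniform bound for a regularized Cauchy integral -/

section SingularIntegral

lemma intervalIntegrable_abs_rpow {r : ℝ} (hr : -1 < r) (a b : ℝ) :
    IntervalIntegrable (fun t : ℝ => |t| ^ r) volume a b := by
  have key : ∀ c : ℝ, 0 ≤ c → IntervalIntegrable (fun t : ℝ => |t| ^ r) volume 0 c := by
    intro c hc
    refine (intervalIntegral.intervalIntegrable_rpow' hr (a := 0) (b := c)).congr ?_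
    intro t ht
    rw [uIoc_of_le hc] at ht
    simp only [abs_of_pos ht.1]
  have key' : ∀ c : ℝ, IntervalIntegrable (fun t : ℝ => |t| ^ r) volume 0 c := by
    intro c
    rcases le_total 0 c with hc | hc
    · exact key c hc
    · have := (key (-c) (by linarith)).comp_sub_left 0
      simpa using this
  exact (key' a).symm.trans (key' b)

/-- The kernel `Re (1 / (t + i e))`. -/
noncomputable def reCauchyKernel (e t : ℝ) : ℝ := t / (t ^ 2 + e ^ 2)

lemma abs_reCauchyKernel_mul_le (e t : ℝ) : |reCauchyKernel e t| * |t| ≤ 1 := by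
  rw [reCauchyKernel, abs_div, abs_of_nonneg (by positivity : 0 ≤ t ^ 2 + e ^ 2),
    div_mul_eq_mul_div, ← sq, sq_abs]
  exact div_le_one_of_le₀ (by nlinarith [sq_nonneg e]) (by positivity)

lemma continuous_reCauchyKernel {e : ℝ} (he : e ≠ 0) : Continuous (reCauchyKernel e) := by
  unfold reCauchyKernel
  exact continuous_id.div (by fun_prop) fun t => by positivity

/-- The primitive is `log |U - c + ie|`. It evaluates the singular integral with constant density
exactly, which captures the cancellation across the singularity. -/
lemma hasDerivAt_half_log {U U' : ℝ → ℝ} {y : ℝ} (hU : HasDerivAt U (U' y) y) {e : ℝ}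
    (he : e ≠ 0) (c : ℝ) :
    HasDerivAt (fun y => 1 / 2 * Real.log ((U y - c) ^ 2 + e ^ 2))
      (U' y * reCauchyKernel e (U y - c)) y := by
  have h1 : HasDerivAt (fun y => (U y - c) ^ 2 + e ^ 2) (2 * (U y - c) * U' y) y := by
    have := ((hU.sub_const c).pow 2).add_const (e ^ 2)
    convert! this using 1
    norm_num
  have hpos : (U y - c) ^ 2 + e ^ 2 ≠ 0 := by positivity
  convert! (h1.log hpos).const_mul (1 / 2) using 1
  unfold reCauchyKernel
  ring

/-- The logarithm is at most `log (B/A)`, since adding `e²` brings the ratio closer to `1`. It blows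
up as `A → 0`, but `log t ≤ t^α / α` and the factor `A^α` in the bound for `c` cancel the blow-up,
leaving `(2B)^α ≤ 8`. -/
lemma mul_abs_half_log_sub_le {α A B e M c : ℝ} (hα : 0 < α) (hα1 : α ≤ 1) (hA : 0 < A)
    (hAB : A ≤ B) (hB : B ≤ 4) (hM : 0 ≤ M) (hc : |c| ≤ M * (2 * A) ^ α) :
    |c| * |1 / 2 * Real.log (B ^ 2 + e ^ 2) - 1 / 2 * Real.log (A ^ 2 + e ^ 2)| ≤ 8 * M / α := by
  have hB0 : 0 < B := hA.trans_le hAB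
  have h0 : 0 ≤ 1 / 2 * Real.log (B ^ 2 + e ^ 2) - 1 / 2 * Real.log (A ^ 2 + e ^ 2) := by
    have := Real.log_le_log (by positivity : 0 < A ^ 2 + e ^ 2)
      (by nlinarith : A ^ 2 + e ^ 2 ≤ B ^ 2 + e ^ 2)
    linarith
  have h1 : 1 / 2 * Real.log (B ^ 2 + e ^ 2) - 1 / 2 * Real.log (A ^ 2 + e ^ 2)
      ≤ Real.log (B / A) := by
    have h2 : Real.log ((B ^ 2 + e ^ 2) / (A ^ 2 + e ^ 2)) ≤ Real.log ((B / A) ^ 2) := by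
      refine Real.log_le_log (by positivity) ?_
      rw [div_pow, div_le_div_iff₀ (by positivity) (by positivity)]
      nlinarith [mul_nonneg (sq_nonneg e) (by nlinarith : 0 ≤ B ^ 2 - A ^ 2)]
    rw [Real.log_div (by positivity) (by positivity), Real.log_pow] at h2
    push_cast at h2
    linarith
  have h3 : Real.log (B / A) ≤ (B / A) ^ α / α := Real.log_le_rpow_div (by positivity) hα
  rw [abs_of_nonneg h0]
  calc |c| * (1 / 2 * Real.log (B ^ 2 + e ^ 2) - 1 / 2 * Real.log (A ^ 2 + e ^ 2))
      ≤ M * (2 * A) ^ α * ((B / A) ^ α / α) :=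
        mul_le_mul hc (h1.trans h3) h0 (by positivity)
    _ = M * (2 * B) ^ α / α := by
        rw [mul_assoc, ← mul_div_assoc, ← Real.mul_rpow (by positivity) (by positivity)]
        rw [show 2 * A * (B / A) = 2 * B by field_simp]
        ring
    _ ≤ M * 8 / α := by
        gcongr
        calc (2 * B) ^ α ≤ 8 ^ α := Real.rpow_le_rpow (by positivity) (by linarith) hα.le
          _ ≤ 8 ^ (1 : ℝ) := Real.rpow_le_rpow_of_exponent_le (by norm_num) hα1
          _ = 8 := by norm_num
    _ = _ := by ring

lemma sub_le_and_le_of_hasDerivAt {U U' : ℝ → ℝ} (hU : ∀ y, HasDerivAt U (U' y) y)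
    (hl : ∀ y, 1 / 2 ≤ U' y) (hu : ∀ y, U' y ≤ 2) {x y : ℝ} (hxy : x ≤ y) :
    1 / 2 * (y - x) ≤ U y - U x ∧ U y - U x ≤ 2 * (y - x) := by
  have hd : Differentiable ℝ U := fun y => (hU y).differentiableAt
  constructor
  · exact mul_sub_le_image_sub_of_le_deriv hd (fun y => by rw [(hU y).deriv]; exact hl y) hxy
  · exact image_sub_le_mul_sub_of_deriv_le hd (fun y => by rw [(hU y).deriv]; exact hu y) hxy

lemma exists_eq_of_hasDerivAt {U U' : ℝ → ℝ} (hU : ∀ y, HasDerivAt U (U' y) y)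
    (hl : ∀ y, 1 / 2 ≤ U' y) (hu : ∀ y, U' y ≤ 2) (c : ℝ) : ∃ z, U z = c := by
  have hc : Continuous U := continuous_iff_continuousAt.2 fun y => (hU y).continuousAt
  -- Slope at least `1/2` makes `U` vary by at least `|c - U 0|` over a length `R`.
  set R := 2 * |c - U 0| with hR
  have hR0 : 0 ≤ R := by positivity
  have h1 := (sub_le_and_le_of_hasDerivAt hU hl hu hR0).1
  have h2 := (sub_le_and_le_of_hasDerivAt hU hl hu (neg_nonpos.2 hR0)).1
  have h3 := le_abs_self (c - U 0)
  have h4 := neg_abs_le (c - U 0)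
  obtain ⟨z, -, hz⟩ := intermediate_value_Icc (by linarith : -R ≤ R) hc.continuousOn
    (⟨by linarith, by linarith⟩ : c ∈ Icc (U (-R)) (U R))
  exact ⟨z, hz⟩

/-- A singular integral with Cauchy kernel against a Hölder function that vanishes at the
endpoints is bounded uniformly in the position of the singularity. -/
lemma abs_integral_reCauchyKernel_le {α : ℝ} (hα : 0 < α) (hα1 : α ≤ 1) :
    ∃ C : ℝ, 0 < C ∧ ∀ (U U' h : ℝ → ℝ) (M c e : ℝ), (∀ y, HasDerivAt U (U' y) y) →
      Continuous U' → (∀ y, 1 / 2 ≤ U' y) → (∀ y, U' y ≤ 2) → Continuous h → 0 ≤ M →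
      (∀ x ∈ Icc (-1 : ℝ) 1, ∀ y ∈ Icc (-1 : ℝ) 1, |h x - h y| ≤ M * |x - y| ^ α) →
      h (-1) = 0 → h 1 = 0 → e ≠ 0 →
      |∫ y in (-1 : ℝ)..1, h y * (U' y * reCauchyKernel e (U y - c))| ≤ C * M := by
  set J := ∫ t in (-2 : ℝ)..2, |t| ^ (α - 1) with hJ
  have hJ0 : 0 ≤ J := intervalIntegral.integral_nonneg (by norm_num) fun t _ => by positivity
  refine ⟨4 * J + 8 / α, by positivity, ?_⟩
  intro U U' h M c e hU hU'c hl hu hhc hM hh hm1 hp1 he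
  have hUc : Continuous U := continuous_iff_continuousAt.2 fun y => (hU y).continuousAt
  have hKc : Continuous fun y => U' y * reCauchyKernel e (U y - c) :=
    hU'c.mul ((continuous_reCauchyKernel he).comp (hUc.sub continuous_const))
  obtain ⟨z, hz⟩ := exists_eq_of_hasDerivAt hU hl hu c
  -- The zero `z` of `U - c` may lie outside the channel; `p` is the point of `[-1,1]` nearest to
  -- it, so `|y - p| ≤ |y - z|` there.
  set p : ℝ := max (-1) (min 1 z) with hp
  have hpm : p ∈ Icc (-1 : ℝ) 1 := ⟨le_max_left _ _, max_le (by norm_num) (min_le_left _ _)⟩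
  have hdist : ∀ y ∈ Icc (-1 : ℝ) 1, |y - p| ≤ |y - z| := by
    intro y hy
    rcases le_total z (-1) with h1 | h1
    · rw [hp, min_eq_right (by linarith), max_eq_left h1, abs_of_nonneg (by linarith [hy.1]),
        abs_of_nonneg (by linarith [hy.1])]
      linarith
    · rcases le_total 1 z with h2 | h2
      · rw [hp, min_eq_left h2, max_eq_right (by norm_num), abs_of_nonpos (by linarith [hy.2]),
          abs_of_nonpos (by linarith [hy.2])]
        linarith
      · rw [hp, min_eq_right h2, max_eq_right h1]
  have hUz : ∀ y, |y - z| ≤ 2 * |U y - c| := by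
    intro y
    rw [← hz]
    rcases le_total z y with h1 | h1
    · have := (sub_le_and_le_of_hasDerivAt hU hl hu h1).1
      rw [abs_of_nonneg (by linarith), abs_of_nonneg (by linarith)]; linarith
    · have := (sub_le_and_le_of_hasDerivAt hU hl hu h1).1
      rw [abs_of_nonpos (by linarith), abs_of_nonpos (by linarith)]; linarith
  have hpt : ∀ y ∈ Icc (-1 : ℝ) 1,
      |(h y - h p) * (U' y * reCauchyKernel e (U y - c))| ≤ 4 * M * |y - p| ^ (α - 1) := by
    intro y hy
    rcases (abs_nonneg (y - p)).eq_or_lt with h0 | h0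
    · have : y = p := by
        have := abs_eq_zero.1 h0.symm
        linarith
      rw [this]
      simp only [sub_self, zero_mul, abs_zero]
      positivity
    · have hK : |reCauchyKernel e (U y - c)| ≤ 2 / |y - p| := by
        rw [le_div_iff₀ h0]
        calc _ ≤ |reCauchyKernel e (U y - c)| * (2 * |U y - c|) :=
              mul_le_mul_of_nonneg_left ((hdist y hy).trans (hUz y)) (abs_nonneg _)
          _ ≤ 2 := by linarith [abs_reCauchyKernel_mul_le e (U y - c)]
      rw [abs_mul, abs_mul, abs_of_nonneg (by linarith [hl y] : 0 ≤ U' y)]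
      calc _ ≤ (M * |y - p| ^ α) * (2 * (2 / |y - p|)) := by
            refine mul_le_mul (hh y hy p hpm) (mul_le_mul (hu y) hK (abs_nonneg _) (by norm_num))
              (mul_nonneg (by linarith [hl y]) (abs_nonneg _)) (by positivity)
        _ = _ := by
            rw [Real.rpow_sub_one h0.ne']; ring
  have hfirst : |∫ y in (-1 : ℝ)..1, (h y - h p) * (U' y * reCauchyKernel e (U y - c))|
      ≤ 4 * M * J := by
    have hI1 : IntervalIntegrable (fun y : ℝ => |y - p| ^ (α - 1)) volume (-1) 1 := by
      have := (intervalIntegrable_abs_rpow (by linarith : -1 < α - 1) (-1 - p)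
        (1 - p)).comp_sub_right p
      simpa using this
    -- After translation the interval lies in `[-2, 2]`, so the bound does not depend on `p`.
    have hle : ∫ y in (-1 : ℝ)..1, |y - p| ^ (α - 1) ≤ J := by
      rw [intervalIntegral.integral_comp_sub_right (fun t : ℝ => |t| ^ (α - 1))]
      exact intervalIntegral.integral_mono_interval (by linarith [hpm.2]) (by linarith)
        (by linarith [hpm.1]) (Filter.Eventually.of_forall fun t => by positivity)
        (intervalIntegrable_abs_rpow (by linarith) _ _)
    calc _ ≤ ∫ y in (-1 : ℝ)..1, 4 * M * |y - p| ^ (α - 1) := by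
          refine (intervalIntegral.abs_integral_le_integral_abs (by norm_num)).trans ?_
          refine intervalIntegral.integral_mono_on (by norm_num) ?_ (hI1.const_mul _) hpt
          exact Continuous.intervalIntegrable (((hhc.sub continuous_const).mul hKc).abs) _ _
      _ = 4 * M * ∫ y in (-1 : ℝ)..1, |y - p| ^ (α - 1) :=
          intervalIntegral.integral_const_mul _ _
      _ ≤ _ := mul_le_mul_of_nonneg_left hle (by positivity)
  -- If `z` is not interior, `p` is a wall and `h p = 0`. Otherwise `A` is the smaller of the two
  -- values of `|U - c|` at the walls, and the vanishing of `h` at that wall gives `|h z| ≤ M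
  -- (2A)^α`.
  have hsecond : |h p| * |∫ y in (-1 : ℝ)..1, U' y * reCauchyKernel e (U y - c)|
      ≤ 8 * M / α := by
    have hnn : 0 ≤ 8 * M / α := by positivity
    rcases le_or_gt z (-1) with h1 | h1
    · rw [hp, min_eq_right (by linarith), max_eq_left h1, hm1]; simpa using hnn
    rcases le_or_gt 1 z with h2 | h2
    · rw [hp, min_eq_left h2, max_eq_right (by norm_num), hp1]; simpa using hnn
    have hpz : p = z := by rw [hp, min_eq_right h2.le, max_eq_right h1.le]
    rw [hpz, intervalIntegral.integral_eq_sub_of_hasDerivAt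
      (fun y _ => hasDerivAt_half_log (hU y) he c) (hKc.intervalIntegrable _ _)]
    have hA := sub_le_and_le_of_hasDerivAt hU hl hu h2.le
    have hB := sub_le_and_le_of_hasDerivAt hU hl hu h1.le
    rw [hz] at hA hB
    have hzm : z ∈ Icc (-1 : ℝ) 1 := ⟨h1.le, h2.le⟩
    rcases le_total (U 1 - c) (c - U (-1)) with hAB | hAB
    · rw [abs_sub_comm, show (U (-1) - c) ^ 2 = (c - U (-1)) ^ 2 by ring]
      refine mul_abs_half_log_sub_le hα hα1 (by linarith) hAB (by linarith) hM ?_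
      have := hh z hzm 1 (by norm_num)
      rw [hp1, sub_zero] at this
      refine this.trans (mul_le_mul_of_nonneg_left
        (Real.rpow_le_rpow (abs_nonneg _) ?_ hα.le) hM)
      rw [abs_of_neg (by linarith)]; linarith
    · rw [show (U (-1) - c) ^ 2 = (c - U (-1)) ^ 2 by ring]
      refine mul_abs_half_log_sub_le hα hα1 (by linarith) hAB (by linarith) hM ?_
      have := hh z hzm (-1) (by norm_num)
      rw [hm1, sub_zero] at this
      refine this.trans (mul_le_mul_of_nonneg_left
        (Real.rpow_le_rpow (abs_nonneg _) ?_ hα.le) hM)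
      rw [abs_of_pos (by linarith)]; linarith
  have hsplit : ∫ y in (-1 : ℝ)..1, h y * (U' y * reCauchyKernel e (U y - c)) =
      (∫ y in (-1 : ℝ)..1, (h y - h p) * (U' y * reCauchyKernel e (U y - c))) +
        h p * ∫ y in (-1 : ℝ)..1, U' y * reCauchyKernel e (U y - c) := by
    rw [← intervalIntegral.integral_const_mul, ← intervalIntegral.integral_add]
    · congr 1; funext y; ring
    · exact ((hhc.sub continuous_const).mul hKc).intervalIntegrable _ _
    · exact (continuous_const.mul hKc).intervalIntegrable _ _
  rw [hsplit]
  refine (abs_add_le _ _).trans ?_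
  rw [abs_mul]
  calc _ ≤ 4 * M * J + 8 * M / α := add_le_add hfirst hsecond
    _ = _ := by ring

end SingularIntegral

/-! ### Energy estimate for the Rayleigh equation -/

section RayleighEquation

/-- Cauchy–Schwarz against the constant `1`, obtained by expanding `∫ ((b - a) f - J)² ≥ 0`. -/
lemma sq_integral_le_mul_integral_sq {a b : ℝ} (hab : a ≤ b) {f : ℝ → ℝ} (hf : Continuous f) :
    (∫ t in a..b, f t) ^ 2 ≤ (b - a) * ∫ t in a..b, f t ^ 2 := by
  rcases hab.eq_or_lt with h | h
  · simp [h]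
  set J := ∫ t in a..b, f t
  have h0 : 0 ≤ ∫ t in a..b, ((b - a) * f t - J) ^ 2 :=
    intervalIntegral.integral_nonneg hab fun t _ => sq_nonneg _
  have h1 : ∫ t in a..b, ((b - a) * f t - J) ^ 2 =
      (b - a) ^ 2 * (∫ t in a..b, f t ^ 2) - 2 * (b - a) * J * J + (b - a) * J ^ 2 := by
    have e : (fun t => ((b - a) * f t - J) ^ 2) =
        fun t => ((b - a) ^ 2 * f t ^ 2 - 2 * (b - a) * J * f t) + J ^ 2 := by
      funext t; ring
    rw [e, intervalIntegral.integral_add, intervalIntegral.integral_sub,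
      intervalIntegral.integral_const_mul, intervalIntegral.integral_const_mul,
      intervalIntegral.integral_const, smul_eq_mul]
    all_goals exact Continuous.intervalIntegrable (by fun_prop) _ _
  rw [h1] at h0
  have h2 : 0 < b - a := by linarith
  by_contra hcon
  push Not at hcon
  nlinarith [mul_lt_mul_of_pos_left hcon h2]

/-- The embedding of `H¹` in `C^{1/2}`: the fundamental theorem of calculus followed by
Cauchy–Schwarz. The exponent `1/2` is why `α ≤ 1/2` is imposed later. -/
lemma norm_sub_sq_le {V V' : ℝ → ℂ} (hV : ∀ y, HasDerivAt V (V' y) y) (hV' : Continuous V')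
    {x y : ℝ} (hx : x ∈ Icc (-1 : ℝ) 1) (hy : y ∈ Icc (-1 : ℝ) 1) :
    ‖V x - V y‖ ^ 2 ≤ |x - y| * ∫ t in (-1 : ℝ)..1, ‖V' t‖ ^ 2 := by
  wlog hxy : x ≤ y generalizing x y
  · rw [norm_sub_rev, abs_sub_comm]
    exact this hy hx (le_of_not_ge hxy)
  have h1 : ∫ t in x..y, V' t = V y - V x :=
    intervalIntegral.integral_eq_sub_of_hasDerivAt (fun t _ => hV t)
      (hV'.intervalIntegrable _ _)
  have h2 : ‖V x - V y‖ ≤ ∫ t in x..y, ‖V' t‖ := by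
    rw [norm_sub_rev, ← h1]
    exact intervalIntegral.norm_integral_le_integral_norm hxy
  have h3 := sq_integral_le_mul_integral_sq hxy hV'.norm
  have h4 : ∫ t in x..y, ‖V' t‖ ^ 2 ≤ ∫ t in (-1 : ℝ)..1, ‖V' t‖ ^ 2 :=
    intervalIntegral.integral_mono_interval hx.1 hxy hy.2
      (Filter.Eventually.of_forall fun t => by positivity)
      (Continuous.intervalIntegrable (by fun_prop) _ _)
  calc ‖V x - V y‖ ^ 2 ≤ (∫ t in x..y, ‖V' t‖) ^ 2 := by gcongr
    _ ≤ (y - x) * ∫ t in x..y, ‖V' t‖ ^ 2 := h3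
    _ ≤ (y - x) * ∫ t in (-1 : ℝ)..1, ‖V' t‖ ^ 2 :=
        mul_le_mul_of_nonneg_left h4 (by linarith)
    _ = _ := by rw [abs_sub_comm, abs_of_nonneg (by linarith : 0 ≤ y - x)]

/-- Rescaling by the diameter `2` of the channel makes the base at most `1`. This lowers all Hölder
exponents to the common `α`. -/
lemma rpow_le_two_mul_rpow {α β d : ℝ} (hβα : α ≤ β) (hα : 0 ≤ α) (hβ : β ≤ 1) (hd : 0 < d)
    (hd2 : d ≤ 2) : d ^ β ≤ 2 * d ^ α := by
  have h1 : (d / 2) ^ β ≤ (d / 2) ^ α :=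
    Real.rpow_le_rpow_of_exponent_ge (by positivity) (by linarith) hβα
  have h2 : (2 : ℝ) ^ β ≤ 2 := by
    conv_rhs => rw [← Real.rpow_one 2]
    exact Real.rpow_le_rpow_of_exponent_le (by norm_num) hβ
  have h3 : (1 : ℝ) ≤ 2 ^ α := Real.one_le_rpow (by norm_num) hα
  calc d ^ β = 2 ^ β * (d / 2) ^ β := by
        rw [← Real.mul_rpow (by norm_num) (by positivity)]; congr 1; ring
    _ ≤ 2 * (d / 2) ^ α := mul_le_mul h2 h1 (by positivity) (by norm_num)
    _ ≤ 2 * d ^ α := by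
        gcongr
        linarith

/-- The potential term of the Rayleigh equation is controlled by the Dirichlet energy. -/
lemma abs_integral_potential_le {α : ℝ} (hα : 0 < α) (hα1 : α ≤ 1 / 2) :
    ∃ C : ℝ, 0 < C ∧ ∀ (U U' U'' : ℝ → ℝ) (V V' : ℝ → ℂ) (δ c e : ℝ),
      (∀ y, HasDerivAt U (U' y) y) → (∀ y, HasDerivAt U' (U'' y) y) → Continuous U'' →
      0 ≤ δ → δ ≤ 1 / 2 → (∀ y, |U' y - 1| ≤ δ) → (∀ y, |U'' y| ≤ δ) →
      (∀ x y, |U'' x - U'' y| ≤ δ * |x - y| ^ α) →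
      (∀ y, HasDerivAt V (V' y) y) → Continuous V' → V (-1) = 0 → V 1 = 0 → e ≠ 0 →
      |∫ y in (-1 : ℝ)..1, U'' y * ‖V y‖ ^ 2 * reCauchyKernel e (U y - c)| ≤
        C * δ * ∫ y in (-1 : ℝ)..1, ‖V' y‖ ^ 2 := by
  obtain ⟨C, hC, hmain⟩ := abs_integral_reCauchyKernel_le hα (by linarith : α ≤ 1)
  -- The product rule for the Hölder bound of `U''|V|²/U'` contributes `4 + 16 + 8`, so `36` leaves
  -- slack.
  refine ⟨C * 36, by positivity, ?_⟩
  intro U U' U'' V V' δ c e hU hU' hU''c hδ hδ1 hb' hb'' hhol hV hV'c hm hp he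
  set N := ∫ y in (-1 : ℝ)..1, ‖V' y‖ ^ 2 with hN
  have hN0 : 0 ≤ N := intervalIntegral.integral_nonneg (by norm_num) fun t _ => by positivity
  have hl : ∀ y, 1 / 2 ≤ U' y := fun y => by linarith [(abs_le.1 (hb' y)).1]
  have hu : ∀ y, U' y ≤ 2 := fun y => by linarith [(abs_le.1 (hb' y)).2]
  have hU'c : Continuous U' := continuous_iff_continuousAt.2 fun y => (hU' y).continuousAt
  have hVc : Continuous V := continuous_iff_continuousAt.2 fun y => (hV y).continuousAt
  have hU'0 : ∀ y, U' y ≠ 0 := fun y => by linarith [hl y]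
  set n := Real.sqrt N with hn
  have hn0 : 0 ≤ n := Real.sqrt_nonneg _
  have hnn : n * n = N := Real.mul_self_sqrt hN0
  have hVle : ∀ y ∈ Icc (-1 : ℝ) 1, ‖V y‖ ≤ 2 * n := by
    intro y hy
    have := norm_sub_sq_le hV hV'c hy (by norm_num : (-1 : ℝ) ∈ Icc (-1 : ℝ) 1)
    rw [hm, sub_zero, abs_of_nonneg (by linarith [hy.1])] at this
    refine abs_le_of_sq_le_sq' ?_ (by positivity) |>.2
    nlinarith [hy.2]
  have hVsq : ∀ y ∈ Icc (-1 : ℝ) 1, ‖V y‖ ^ 2 ≤ 2 * N := by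
    intro y hy
    have := norm_sub_sq_le hV hV'c hy (by norm_num : (-1 : ℝ) ∈ Icc (-1 : ℝ) 1)
    rw [hm, sub_zero, abs_of_nonneg (by linarith [hy.1])] at this
    nlinarith [hy.2]
  have hVhol : ∀ x ∈ Icc (-1 : ℝ) 1, ∀ y ∈ Icc (-1 : ℝ) 1, x ≠ y →
      |‖V x‖ ^ 2 - ‖V y‖ ^ 2| ≤ 8 * N * |x - y| ^ α := by
    intro x hx y hy hxy
    have hd : 0 < |x - y| := abs_pos.2 (sub_ne_zero.2 hxy)
    have hd2 : |x - y| ≤ 2 := abs_le.2 ⟨by linarith [hx.1, hy.2], by linarith [hx.2, hy.1]⟩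
    have h1 : ‖V x - V y‖ ≤ n * |x - y| ^ (1 / 2 : ℝ) := by
      refine abs_le_of_sq_le_sq' ?_ (by positivity) |>.2
      have h2 := norm_sub_sq_le hV hV'c hx hy
      rw [mul_pow, ← Real.rpow_mul_natCast (abs_nonneg _), sq n, hnn]
      norm_num
      linarith
    have h3 := rpow_le_two_mul_rpow hα1 hα.le (by norm_num) hd hd2
    have h4 : ‖V x - V y‖ ≤ n * (2 * |x - y| ^ α) :=
      h1.trans (mul_le_mul_of_nonneg_left h3 hn0)
    have h5 := abs_norm_sub_norm_le (V x) (V y)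
    rw [show ‖V x‖ ^ 2 - ‖V y‖ ^ 2 = (‖V x‖ - ‖V y‖) * (‖V x‖ + ‖V y‖) by ring, abs_mul,
      abs_of_nonneg (by positivity : 0 ≤ ‖V x‖ + ‖V y‖)]
    calc _ ≤ (n * (2 * |x - y| ^ α)) * (2 * n + 2 * n) :=
          mul_le_mul (h5.trans h4) (add_le_add (hVle x hx) (hVle y hy)) (by positivity)
            (by positivity)
      _ = _ := by rw [← hnn]; ring
  have hinvle : ∀ y, |(U' y)⁻¹| ≤ 2 := by
    intro y
    rw [abs_inv, abs_of_pos (by linarith [hl y]), inv_le_comm₀ (by linarith [hl y]) (by norm_num)]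
    linarith [hl y]
  have hU'lip : ∀ x y, |U' x - U' y| ≤ δ * |x - y| := by
    intro x y
    have := Convex.norm_image_sub_le_of_norm_hasDerivWithin_le (f := U') (f' := U'') (C := δ)
      (s := Set.univ) (x := y) (y := x) (fun t _ => (hU' t).hasDerivWithinAt)
      (fun t _ => hb'' t) convex_univ (mem_univ _) (mem_univ _)
    simpa using this
  have hinvhol : ∀ x ∈ Icc (-1 : ℝ) 1, ∀ y ∈ Icc (-1 : ℝ) 1, x ≠ y →
      |(U' x)⁻¹ - (U' y)⁻¹| ≤ 4 * |x - y| ^ α := by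
    intro x hx y hy hxy
    have hd : 0 < |x - y| := abs_pos.2 (sub_ne_zero.2 hxy)
    have hd2 : |x - y| ≤ 2 := abs_le.2 ⟨by linarith [hx.1, hy.2], by linarith [hx.2, hy.1]⟩
    have h3 := rpow_le_two_mul_rpow (by linarith : α ≤ 1) hα.le le_rfl hd hd2
    rw [Real.rpow_one] at h3
    rw [show (U' x)⁻¹ - (U' y)⁻¹ = (U' x)⁻¹ * (U' y)⁻¹ * (U' y - U' x) by
      field_simp [hU'0 x, hU'0 y], abs_mul, abs_mul]
    calc _ ≤ 2 * 2 * (δ * |y - x|) := by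
          refine mul_le_mul (mul_le_mul (hinvle x) (hinvle y) (abs_nonneg _) (by norm_num))
            (hU'lip y x) (abs_nonneg _) (by norm_num)
      _ ≤ 2 * |x - y| := by rw [abs_sub_comm y x]; nlinarith
      _ ≤ _ := by linarith
  -- Dividing by `U'` makes the derivative of the logarithm appear as the kernel.
  have key := hmain U U' (fun y => U'' y * ‖V y‖ ^ 2 * (U' y)⁻¹) (36 * δ * N) c e hU hU'c hl hu
    ((hU''c.mul (by fun_prop)).mul (hU'c.inv₀ hU'0)) (by positivity) ?_
    (by simp [hm]) (by simp [hp]) he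
  · have e1 : ∀ y, U'' y * ‖V y‖ ^ 2 * reCauchyKernel e (U y - c) =
        U'' y * ‖V y‖ ^ 2 * (U' y)⁻¹ * (U' y * reCauchyKernel e (U y - c)) := by
      intro y
      field_simp [hU'0 y]
    simp only [e1]
    refine key.trans (le_of_eq ?_)
    ring
  · intro x hx y hy
    rcases eq_or_ne x y with rfl | hxy
    · simp only [sub_self, abs_zero]
      positivity
    have a1 := hhol x y
    have a2 := hVhol x hx y hy hxy
    have a3 := hinvhol x hx y hy hxy
    have hX : 0 ≤ |x - y| ^ α := by positivity
    have e1 : U'' x * ‖V x‖ ^ 2 * (U' x)⁻¹ - U'' y * ‖V y‖ ^ 2 * (U' y)⁻¹ =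
        (U'' x - U'' y) * ‖V x‖ ^ 2 * (U' x)⁻¹ + U'' y * (‖V x‖ ^ 2 - ‖V y‖ ^ 2) * (U' x)⁻¹ +
          U'' y * ‖V y‖ ^ 2 * ((U' x)⁻¹ - (U' y)⁻¹) := by ring
    rw [e1]
    refine (abs_add_three _ _ _).trans ?_
    simp only [abs_mul, abs_pow, abs_norm]
    have b1 : |U'' x - U'' y| * ‖V x‖ ^ 2 * |(U' x)⁻¹| ≤ δ * |x - y| ^ α * (2 * N) * 2 :=
      mul_le_mul (mul_le_mul a1 (hVsq x hx) (by positivity) (by positivity)) (hinvle x)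
        (abs_nonneg _) (by positivity)
    have b2 : |U'' y| * |‖V x‖ ^ 2 - ‖V y‖ ^ 2| * |(U' x)⁻¹| ≤ δ * (8 * N * |x - y| ^ α) * 2 :=
      mul_le_mul (mul_le_mul (hb'' y) a2 (by positivity) (by positivity)) (hinvle x)
        (abs_nonneg _) (by positivity)
    have b3 : |U'' y| * ‖V y‖ ^ 2 * |(U' x)⁻¹ - (U' y)⁻¹| ≤ δ * (2 * N) * (4 * |x - y| ^ α) :=
      mul_le_mul (mul_le_mul (hb'' y) (hVsq y hy) (by positivity) (by positivity)) a3
        (abs_nonneg _) (by positivity)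
    nlinarith [mul_nonneg (mul_nonneg hδ hN0) hX]

/-- If `U` is close to the Couette flow in `C^{2,α}`, the Rayleigh equation has no nonzero
solution with `Re λ > 0`. -/
lemma rayleigh_eq_zero {α : ℝ} (hα : 0 < α) (hα1 : α ≤ 1 / 2) :
    ∃ δ : ℝ, 0 < δ ∧ δ ≤ 1 / 2 ∧ ∀ (U U' U'' : ℝ → ℝ) (V V' : ℝ → ℂ) (k : ℝ) (lam : ℂ),
      (∀ y, HasDerivAt U (U' y) y) → (∀ y, HasDerivAt U' (U'' y) y) → Continuous U'' →
      (∀ y, |U' y - 1| ≤ δ) → (∀ y, |U'' y| ≤ δ) →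
      (∀ x y, |U'' x - U'' y| ≤ δ * |x - y| ^ α) →
      (∀ y, HasDerivAt V (V' y) y) → Continuous V' → V (-1) = 0 → V 1 = 0 → k ≠ 0 →
      0 < lam.re →
      (∀ y ∈ Ioo (-1 : ℝ) 1, HasDerivAt V'
        (k ^ 2 * V y + Complex.I * k * U'' y / (lam + Complex.I * k * U y) * V y) y) →
      ∀ y ∈ Icc (-1 : ℝ) 1, V y = 0 := by
  obtain ⟨C, hC, hmain⟩ := abs_integral_potential_le hα hα1
  -- With `δ ≤ 1/(2C)` the potential term is at most half the Dirichlet energy.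
  refine ⟨min (1 / 2) (1 / (2 * C)), by positivity, min_le_left _ _, ?_⟩
  set δ := min (1 / 2) (1 / (2 * C)) with hδ
  intro U U' U'' V V' k lam hU hU' hU''c hb' hb'' hhol hV hV'c hm hp hk hlam hV'
  set V'' : ℝ → ℂ := fun y => k ^ 2 * V y +
    Complex.I * k * U'' y / (lam + Complex.I * k * U y) * V y with hode
  have hUc : Continuous U := continuous_iff_continuousAt.2 fun y => (hU y).continuousAt
  have hVc : Continuous V := continuous_iff_continuousAt.2 fun y => (hV y).continuousAt
  have hne : ∀ y, lam + Complex.I * k * U y ≠ 0 := by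
    intro y h
    have := congrArg Complex.re h
    simp at this
    linarith
  have hV''c : Continuous V'' := by
    exact (continuous_const.mul hVc).add (((by fun_prop : Continuous fun y =>
      Complex.I * k * (U'' y : ℂ)).div (by fun_prop) hne).mul hVc)
  set N := ∫ y in (-1 : ℝ)..1, ‖V' y‖ ^ 2 with hN
  have hN0 : 0 ≤ N := intervalIntegral.integral_nonneg (by norm_num) fun t _ => by positivity
  -- Here `ik / (λ + ikU) = 1 / (U - c - ie)` with `c = -Im λ / k`; the real part is even in `e`, so
  -- the sign is harmless.
  set e := lam.re / k with he
  have he0 : e ≠ 0 := div_ne_zero hlam.ne' hk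
  have hpot := hmain U U' U'' V V' δ (-lam.im / k) e hU hU' hU''c (by positivity)
    (min_le_left _ _) hb' hb'' hhol hV hV'c hm hp he0
  have hstar : ∀ y ∈ Ioo (-1 : ℝ) 1, HasDerivAt (fun y => (V' y * star (V y)).re)
      ((V'' y * star (V y) + V' y * star (V' y)).re) y := by
    intro y hy
    have h2 := (hV' y hy).mul (hV y).star
    exact Complex.reCLM.hasFDerivAt.comp_hasDerivAt y h2
  have hre : ∀ y, (V'' y * star (V y) + V' y * star (V' y)).re =
      ‖V' y‖ ^ 2 + (k ^ 2 * ‖V y‖ ^ 2 +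
        U'' y * ‖V y‖ ^ 2 * reCauchyKernel e (U y - -lam.im / k)) := by
    intro y
    have e1 : V' y * star (V' y) = ((‖V' y‖ ^ 2 : ℝ) : ℂ) := by
      rw [← starRingEnd_apply, Complex.mul_conj, Complex.normSq_eq_norm_sq]
    have e2 : V y * star (V y) = ((‖V y‖ ^ 2 : ℝ) : ℂ) := by
      rw [← starRingEnd_apply, Complex.mul_conj, Complex.normSq_eq_norm_sq]
    have e3 : V'' y * star (V y) + V' y * star (V' y) = ((‖V' y‖ ^ 2 : ℝ) : ℂ) +
        (((k ^ 2 * ‖V y‖ ^ 2 : ℝ) : ℂ) + ((U'' y * ‖V y‖ ^ 2 : ℝ) : ℂ) *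
          (Complex.I * k / (lam + Complex.I * k * U y))) := by
      simp only [hode]
      rw [add_mul, mul_assoc, mul_assoc, e1, e2]
      push_cast
      ring
    have e4 : (Complex.I * k / (lam + Complex.I * k * U y)).re =
        reCauchyKernel e (U y - -lam.im / k) := by
      have hs : 0 < lam.re * lam.re + (lam.im + k * U y) * (lam.im + k * U y) := by
        nlinarith [mul_pos hlam hlam, mul_self_nonneg (lam.im + k * U y)]
      have hs' : 0 < (U y - -lam.im / k) ^ 2 + e ^ 2 := by positivity
      rw [reCauchyKernel, Complex.div_re]
      simp only [Complex.normSq_apply, Complex.add_re, Complex.add_im, Complex.mul_re,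
        Complex.mul_im, Complex.I_re, Complex.I_im, Complex.ofReal_re, Complex.ofReal_im]
      simp only [zero_mul, one_mul, mul_zero, add_zero, zero_add, sub_self, zero_div]
      rw [div_eq_div_iff hs.ne' hs'.ne', he]
      field_simp
      ring
    rw [e3, Complex.add_re, Complex.add_re, Complex.re_ofReal_mul, e4, Complex.ofReal_re,
      Complex.ofReal_re]
  have hKc : Continuous fun y => reCauchyKernel e (U y - -lam.im / k) :=
    (continuous_reCauchyKernel he0).comp (hUc.sub continuous_const)
  have henergy : N + (k ^ 2 * (∫ y in (-1 : ℝ)..1, ‖V y‖ ^ 2) +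
      ∫ y in (-1 : ℝ)..1, U'' y * ‖V y‖ ^ 2 * reCauchyKernel e (U y - -lam.im / k)) = 0 := by
    have h1 : ∫ y in (-1 : ℝ)..1, (V'' y * star (V y) + V' y * star (V' y)).re = 0 := by
      rw [intervalIntegral.integral_eq_sub_of_hasDerivAt_of_le (by norm_num)
        (Continuous.continuousOn (by fun_prop)) hstar
        (Continuous.intervalIntegrable (by fun_prop) _ _), hm, hp]
      simp
    simp only [hre] at h1
    rw [intervalIntegral.integral_add, intervalIntegral.integral_add,
      intervalIntegral.integral_const_mul] at h1
    · exact h1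
    all_goals exact Continuous.intervalIntegrable (by fun_prop) _ _
  have hm0 : 0 ≤ ∫ y in (-1 : ℝ)..1, ‖V y‖ ^ 2 :=
    intervalIntegral.integral_nonneg (by norm_num) fun t _ => by positivity
  have hCδ : C * δ ≤ 1 / 2 := by
    calc C * δ ≤ C * (1 / (2 * C)) := mul_le_mul_of_nonneg_left (min_le_right _ _) hC.le
      _ = 1 / 2 := by field_simp
  -- The `k²` term is nonnegative and is dropped from the energy identity, which leaves `N ≤ N/2`.
  have hNz : N = 0 := by
    have h1 := (abs_le.1 hpot).1
    have h2 : C * δ * N ≤ 1 / 2 * N := mul_le_mul_of_nonneg_right hCδ hN0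
    have h3 := mul_nonneg (sq_nonneg k) hm0
    linarith
  intro y hy
  have := norm_sub_sq_le hV hV'c hy (by norm_num : (-1 : ℝ) ∈ Icc (-1 : ℝ) 1)
  rw [← hN, hNz, hm, sub_zero, mul_zero] at this
  exact norm_eq_zero.1 (pow_eq_zero_iff two_ne_zero |>.1 (le_antisymm this (sq_nonneg _)))

end RayleighEquation

/-! ### Weak derivatives on an interval, with boundary conditions -/

section WeakDerivative

lemma integrableOn_Ioo_mul_continuous {f g : ℝ → ℂ} (hf : IntegrableOn f (Ioo (-1) 1))
    (hg : Continuous g) : IntegrableOn (fun y => f y * g y) (Ioo (-1) 1) :=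
  hf.mul_continuousOn_of_subset hg.continuousOn measurableSet_Ioo isCompact_Icc
    Ioo_subset_Icc_self

/-- Integration by parts for the primitive of an integrable function. -/
lemma integral_primitive_mul_deriv {p : ℝ → ℂ} (hp : IntegrableOn p (Ioo (-1) 1))
    {ψ : ℝ → ℂ} (hψ : ContDiff ℝ 1 ψ) :
    ∫ y in Ioo (-1 : ℝ) 1, (∫ t in Ioo (-1 : ℝ) y, p t) * deriv ψ y =
      (∫ t in Ioo (-1 : ℝ) 1, p t) * ψ 1 - ∫ t in Ioo (-1 : ℝ) 1, p t * ψ t := by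
  set μ := (volume : Measure ℝ).restrict (Ioo (-1) 1) with hμ
  have hψ'c : Continuous (deriv ψ) := hψ.continuous_deriv le_rfl
  have hψc : Continuous ψ := hψ.continuous
  have hbdd : ∀ {f : ℝ → ℂ}, Continuous f → Integrable f μ := fun {f} hf =>
    (hf.continuousOn.integrableOn_Icc (a := -1) (b := 1)).mono_set Ioo_subset_Icc_self
  -- Fubini on the triangle `-1 < t < y < 1`.
  set F : ℝ → ℝ → ℂ := fun y t => {z : ℝ × ℝ | z.2 < z.1}.indicator
    (fun z => deriv ψ z.1 * p z.2) (y, t) with hF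
  have hFi : Integrable (Function.uncurry F) (μ.prod μ) := by
    have h1 := (hbdd hψ'c).mul_prod hp
    exact h1.indicator (measurableSet_lt measurable_snd measurable_fst)
  have hswap := integral_integral_swap hFi
  have hl : ∫ y, ∫ t, F y t ∂μ ∂μ =
      ∫ y in Ioo (-1 : ℝ) 1, (∫ t in Ioo (-1 : ℝ) y, p t) * deriv ψ y := by
    refine setIntegral_congr_fun measurableSet_Ioo fun y hy => ?_
    have : (fun t => F y t) = (Iio y).indicator (fun t => deriv ψ y * p t) := by
      funext t
      simp only [hF, indicator, mem_ofPred_eq, mem_Iio]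
    simp only [this]
    rw [integral_indicator measurableSet_Iio, hμ, Measure.restrict_restrict measurableSet_Iio,
      integral_const_mul, mul_comm]
    congr 3
    ext t; simp only [mem_inter_iff, mem_Iio, mem_Ioo]
    exact ⟨fun h => ⟨h.2.1, h.1⟩, fun h => ⟨h.2, h.1, h.2.trans hy.2⟩⟩
  have hr : ∫ t, ∫ y, F y t ∂μ ∂μ = ∫ t in Ioo (-1 : ℝ) 1, (p t * ψ 1 - p t * ψ t) := by
    refine setIntegral_congr_fun measurableSet_Ioo fun t ht => ?_
    have : (fun y => F y t) = (Ioi t).indicator (fun y => p t * deriv ψ y) := by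
      funext y
      simp only [hF, indicator, mem_ofPred_eq, mem_Ioi]
      split_ifs <;> ring
    simp only [this]
    rw [integral_indicator measurableSet_Ioi, hμ, Measure.restrict_restrict measurableSet_Ioi,
      integral_const_mul]
    have hs : Ioi t ∩ Ioo (-1) 1 = Ioo t 1 := by
      ext y; simp only [mem_inter_iff, mem_Ioi, mem_Ioo]
      exact ⟨fun h => ⟨h.1, h.2.2⟩, fun h => ⟨h.1, ht.1.trans h.1, h.2⟩⟩
    rw [hs, ← integral_Ioc_eq_integral_Ioo, ← intervalIntegral.integral_of_le ht.2.le,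
      intervalIntegral.integral_deriv_eq_sub (fun y _ => (hψ.differentiable one_ne_zero) y)
        (hψ'c.intervalIntegrable _ _)]
    ring
  rw [← hl, hswap, hr, integral_sub, integral_mul_const]
  · exact hp.mul_const _
  · exact integrableOn_Ioo_mul_continuous hp hψc

/-- A function whose distributional derivative on `(-1,1)` is integrable is a primitive of it. -/
lemma ae_eq_primitive_of_integral {p q : ℝ → ℂ} (hp : IntegrableOn p (Ioo (-1) 1))
    (hq : IntegrableOn q (Ioo (-1) 1)) (c₁ c₂ : ℂ)
    (h : ∀ ψ : ℝ → ℂ, ContDiff ℝ ∞ ψ →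
      ∫ y in Ioo (-1 : ℝ) 1, (p y * ψ y + q y * deriv ψ y) = c₁ * ψ 1 + c₂ * ψ (-1)) :
    (∫ t in Ioo (-1 : ℝ) 1, p t = c₁ + c₂) ∧
      ∀ᵐ y ∂(volume.restrict (Ioo (-1 : ℝ) 1)), q y = (∫ t in Ioo (-1 : ℝ) y, p t) - c₂ := by
  have h1 : ∫ t in Ioo (-1 : ℝ) 1, p t = c₁ + c₂ := by
    simpa using h (fun _ => 1) contDiff_const
  refine ⟨h1, ?_⟩
  have hPc : ContinuousOn (fun y => ∫ t in Ioo (-1 : ℝ) y, p t) (Icc (-1) 1) := by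
    have := intervalIntegral.continuousOn_primitive_interval (μ := volume) (f := p) (a := -1)
      (b := 1) (by
        rw [uIcc_of_le (by norm_num), integrableOn_Icc_iff_integrableOn_Ioo]; exact hp)
    rw [uIcc_of_le (by norm_num)] at this
    refine this.congr fun y hy => ?_
    simp only
    rw [intervalIntegral.integral_of_le hy.1, integral_Ioc_eq_integral_Ioo]
  have hPi : IntegrableOn (fun y => ∫ t in Ioo (-1 : ℝ) y, p t) (Ioo (-1) 1) :=
    hPc.integrableOn_Icc.mono_set Ioo_subset_Icc_self
  have hri : IntegrableOn (fun y => q y - ((∫ t in Ioo (-1 : ℝ) y, p t) - c₂)) (Ioo (-1) 1) :=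
    hq.sub (hPi.sub (integrableOn_const (by simp)))
  have hz : ∀ᵐ y, y ∈ Ioo (-1 : ℝ) 1 →
      q y - ((∫ t in Ioo (-1 : ℝ) y, p t) - c₂) = 0 := by
    refine isOpen_Ioo.ae_eq_zero_of_integral_contDiff_smul_eq_zero hri.locallyIntegrableOn ?_
    intro g hg _ hgs
    -- Every bump `g` is the derivative of an admissible test function vanishing at `-1`; comparing
    -- the hypothesis with integration by parts tests the difference against `g`.
    set ψ : ℝ → ℂ := fun y => ∫ t in (-1 : ℝ)..y, (g t : ℂ) with hψ
    have hgc : Continuous fun t => (g t : ℂ) := Complex.continuous_ofReal.comp hg.continuous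
    have hψd : ∀ y, HasDerivAt ψ (g y) y := fun y =>
      intervalIntegral.integral_hasDerivAt_right (hgc.intervalIntegrable _ _)
        (hgc.stronglyMeasurableAtFilter _ _) hgc.continuousAt
    have hψderiv : deriv ψ = fun y => (g y : ℂ) := funext fun y => (hψd y).deriv
    have hψs : ContDiff ℝ ∞ ψ := by
      rw [contDiff_infty_iff_deriv]
      refine ⟨fun y => (hψd y).differentiableAt, ?_⟩
      rw [hψderiv]
      exact Complex.ofRealCLM.contDiff.comp hg
    have hpsi0 : ψ (-1) = 0 := by simp [hψ]
    have hpsi1 : ∫ y in Ioo (-1 : ℝ) 1, (g y : ℂ) = ψ 1 := by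
      simp only [hψ]
      rw [← integral_Ioc_eq_integral_Ioo, intervalIntegral.integral_of_le (by norm_num)]
    have e1 := h ψ hψs
    have e2 := integral_primitive_mul_deriv hp (hψs.of_le (by simp))
    rw [integral_add (integrableOn_Ioo_mul_continuous hp hψs.continuous)
      (integrableOn_Ioo_mul_continuous hq (by rw [hψderiv]; exact hgc)),
      hpsi0, hψderiv] at e1
    rw [hψderiv, h1] at e2
    have e3 : ∀ y, g y • (q y - ((∫ t in Ioo (-1 : ℝ) y, p t) - c₂)) =
        q y * g y - (∫ t in Ioo (-1 : ℝ) y, p t) * g y + c₂ * g y := by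
      intro y; rw [Complex.real_smul]; ring
    rw [← setIntegral_eq_integral_of_forall_compl_eq_zero (s := Ioo (-1 : ℝ) 1)]
    · simp only [e3]
      have i1 := integrableOn_Ioo_mul_continuous hq hgc
      have i2 := integrableOn_Ioo_mul_continuous hPi hgc
      have i3 := integrableOn_Ioo_mul_continuous (f := fun _ => c₂)
        (integrableOn_const (by simp)) hgc
      have i4 : IntegrableOn (fun y => q y * (g y : ℂ) -
        (∫ t in Ioo (-1 : ℝ) y, p t) * (g y : ℂ)) (Ioo (-1) 1) := i1.sub i2
      rw [integral_add i4 i3, integral_sub i1 i2, integral_const_mul, hpsi1]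
      linear_combination e1 - e2
    · intro y hy
      rw [image_eq_zero_of_notMem_tsupport (fun hh => hy (hgs hh)), zero_smul]
  rw [ae_restrict_iff' measurableSet_Ioo]
  filter_upwards [hz] with y hy hyI
  exact sub_eq_zero.1 (hy hyI)

/-- The same, when only test functions that vanish at the endpoints are allowed. -/
lemma exists_ae_eq_primitive_of_integral {p q : ℝ → ℂ} (hp : IntegrableOn p (Ioo (-1) 1))
    (hq : IntegrableOn q (Ioo (-1) 1))
    (h : ∀ ψ : ℝ → ℂ, ContDiff ℝ ∞ ψ → ψ (-1) = 0 → ψ 1 = 0 →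
      ∫ y in Ioo (-1 : ℝ) 1, (p y * ψ y + q y * deriv ψ y) = 0) :
    ∃ c : ℂ, ∀ᵐ y ∂(volume.restrict (Ioo (-1 : ℝ) 1)),
      q y = (∫ t in Ioo (-1 : ℝ) y, p t) + c := by
  have hint : ∀ ψ : ℝ → ℂ, ContDiff ℝ ∞ ψ →
      IntegrableOn (fun y => p y * ψ y + q y * deriv ψ y) (Ioo (-1) 1) := fun ψ hψ =>
    (integrableOn_Ioo_mul_continuous hp hψ.continuous).add
      (integrableOn_Ioo_mul_continuous hq (hψ.continuous_deriv (by simp)))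
  -- Subtracting the affine interpolant of its endpoint values makes any `ψ` admissible; the
  -- integrals for the two affine functions become the boundary constants.
  set l₁ : ℝ → ℂ := fun y => (1 + y) / 2 with hl₁
  set l₂ : ℝ → ℂ := fun y => (1 - y) / 2 with hl₂
  have hofReal : ContDiff ℝ ∞ (fun y : ℝ => (y : ℂ)) := Complex.ofRealCLM.contDiff
  have hs₁ : ContDiff ℝ ∞ l₁ := (contDiff_const.add hofReal).div_const _
  have hs₂ : ContDiff ℝ ∞ l₂ := (contDiff_const.sub hofReal).div_const _
  set c₁ := ∫ y in Ioo (-1 : ℝ) 1, (p y * l₁ y + q y * deriv l₁ y) with hc₁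
  set c₂ := ∫ y in Ioo (-1 : ℝ) 1, (p y * l₂ y + q y * deriv l₂ y) with hc₂
  refine ⟨-c₂, ?_⟩
  have := (ae_eq_primitive_of_integral hp hq c₁ c₂ fun ψ hψ => ?_).2
  · filter_upwards [this] with y hy
    rw [hy, sub_eq_add_neg]
  set B : ℝ → ℂ := fun y => ψ y - (ψ 1 * l₁ y + ψ (-1) * l₂ y) with hB
  have hBs : ContDiff ℝ ∞ B := hψ.sub ((contDiff_const.mul hs₁).add (contDiff_const.mul hs₂))
  have h0 := h B hBs (by simp [hB, hl₁, hl₂]) (by simp [hB, hl₁, hl₂])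
  have hd : ∀ {f : ℝ → ℂ}, ContDiff ℝ ∞ f → ∀ y, HasDerivAt f (deriv f y) y := fun hf y =>
    (hf.differentiable (by simp) y).hasDerivAt
  have hBd : ∀ y, deriv B y = deriv ψ y - (ψ 1 * deriv l₁ y + ψ (-1) * deriv l₂ y) := fun y =>
    ((hd hψ y).sub (((hd hs₁ y).const_mul _).add ((hd hs₂ y).const_mul _))).deriv
  have e : ∀ y, p y * B y + q y * deriv B y = (p y * ψ y + q y * deriv ψ y) -
      (ψ 1 * (p y * l₁ y + q y * deriv l₁ y) + ψ (-1) * (p y * l₂ y + q y * deriv l₂ y)) := by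
    intro y
    rw [hBd]
    simp only [hB]
    ring
  simp only [e] at h0
  have i1 := (hint l₁ hs₁).const_mul (ψ 1)
  have i2 := (hint l₂ hs₂).const_mul (ψ (-1))
  have i3 : IntegrableOn (fun y => ψ 1 * (p y * l₁ y + q y * deriv l₁ y) +
    ψ (-1) * (p y * l₂ y + q y * deriv l₂ y)) (Ioo (-1) 1) := i1.add i2
  rw [integral_sub (hint ψ hψ) i3, integral_add i1 i2,
    integral_const_mul, integral_const_mul, ← hc₁, ← hc₂] at h0
  linear_combination h0

end WeakDerivative

/-! ### Regularity of a single Fourier mode -/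

section Mode

/-- A Fourier mode with wave number `k ≠ 0` of an eigenfunction with `Re λ > 0` vanishes if `U` is
close to the Couette flow in `C^{2,α}`. -/
lemma mode_eq_zero {α : ℝ} (hα : 0 < α) (hα1 : α ≤ 1 / 2) :
    ∃ δ : ℝ, 0 < δ ∧ δ ≤ 1 / 2 ∧ ∀ (U U' U'' : ℝ → ℝ) (u v : ℝ → ℂ) (k : ℝ) (lam : ℂ),
      (∀ y, HasDerivAt U (U' y) y) → (∀ y, HasDerivAt U' (U'' y) y) → Continuous U'' →
      (∀ y, |U' y - 1| ≤ δ) → (∀ y, |U'' y| ≤ δ) →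
      (∀ x y, |U'' x - U'' y| ≤ δ * |x - y| ^ α) →
      IntegrableOn u (Ioo (-1) 1) → IntegrableOn v (Ioo (-1) 1) → k ≠ 0 → 0 < lam.re →
      (∀ ψ : ℝ → ℂ, ContDiff ℝ ∞ ψ →
        ∫ y in Ioo (-1 : ℝ) 1, (-(Complex.I * k) * u y * ψ y + v y * deriv ψ y) = 0) →
      (∀ ψ : ℝ → ℂ, ContDiff ℝ ∞ ψ → ψ (-1) = 0 → ψ 1 = 0 →
        ∫ y in Ioo (-1 : ℝ) 1, (v y * (lam + Complex.I * k * U y) * ψ y +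
          (u y * (lam + Complex.I * k * U y) + v y * U' y) * (Complex.I * k)⁻¹ * deriv ψ y) = 0) →
      (∀ᵐ y ∂(volume.restrict (Ioo (-1 : ℝ) 1)), u y = 0) ∧
        ∀ᵐ y ∂(volume.restrict (Ioo (-1 : ℝ) 1)), v y = 0 := by
  obtain ⟨δ, hδ, hδ1, hmain⟩ := rayleigh_eq_zero hα hα1
  refine ⟨δ, hδ, hδ1, ?_⟩
  intro U U' U'' u v k lam hU hU' hU''c hb' hb'' hhol hu hv hk hlam hdiv heq
  have hUc : Continuous U := continuous_iff_continuousAt.2 fun y => (hU y).continuousAt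
  have hU'c : Continuous U' := continuous_iff_continuousAt.2 fun y => (hU' y).continuousAt
  set D : ℝ → ℂ := fun y => lam + Complex.I * k * U y with hD
  have hDc : Continuous D := by fun_prop
  have hne : ∀ y, D y ≠ 0 := by
    intro y h
    have := congrArg Complex.re h
    simp [hD] at this
    linarith
  have hIk : Complex.I * (k : ℂ) ≠ 0 := mul_ne_zero Complex.I_ne_zero (by exact_mod_cast hk)
  have hIoo : ∀ (f : ℝ → ℂ) (y : ℝ), -1 ≤ y →
      ∫ t in Ioo (-1 : ℝ) y, f t = ∫ t in (-1 : ℝ)..y, f t :=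
    fun f y hy => by rw [intervalIntegral.integral_of_le hy, integral_Ioc_eq_integral_Ioo]
  have hprim : ∀ {f : ℝ → ℂ}, Continuous f → ∀ y,
      HasDerivAt (fun y => ∫ t in (-1 : ℝ)..y, f t) (f y) y := fun {f} hf y =>
    intervalIntegral.integral_hasDerivAt_right (hf.intervalIntegrable _ _)
      (hf.stronglyMeasurableAtFilter _ _) hf.continuousAt
  have hcongr : ∀ {f g : ℝ → ℂ}, (∀ᵐ y ∂(volume.restrict (Ioo (-1 : ℝ) 1)), f y = g y) →
      ∀ y ≤ 1, ∫ t in Ioo (-1 : ℝ) y, f t = ∫ t in Ioo (-1 : ℝ) y, g t := fun {f g} hfg y hy =>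
    integral_congr_ae (ae_restrict_of_ae_restrict_of_subset (Ioo_subset_Ioo_right hy) hfg)
  -- Extension by zero makes the primitive `V₀` continuous on the whole line.
  set u₀ : ℝ → ℂ := (Ioo (-1 : ℝ) 1).indicator fun t => -(Complex.I * k) * u t with hu₀
  have hui : IntegrableOn (fun t => -(Complex.I * k) * u t) (Ioo (-1) 1) := hu.const_mul _
  have hu₀i : Integrable u₀ := (integrable_indicator_iff measurableSet_Ioo).2 hui
  set V₀ : ℝ → ℂ := fun y => ∫ t in (-1 : ℝ)..y, u₀ t with hV₀
  have hV₀c : Continuous V₀ :=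
    intervalIntegral.continuous_primitive (fun a b => hu₀i.intervalIntegrable) _
  have hV₀eq : ∀ y ∈ Icc (-1 : ℝ) 1, ∫ t in Ioo (-1 : ℝ) y, -(Complex.I * k) * u t = V₀ y := by
    intro y hy
    simp only [hV₀]
    rw [← hIoo _ _ hy.1]
    refine setIntegral_congr_fun measurableSet_Ioo fun t ht => ?_
    simp only [hu₀]
    rw [indicator_of_mem (show t ∈ Ioo (-1 : ℝ) 1 from ⟨ht.1, ht.2.trans_le hy.2⟩)]
  -- Test functions free at the walls encode both `v' = -ik u` and `v(±1) = 0`.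
  obtain ⟨hV₀1, hvae⟩ := ae_eq_primitive_of_integral hui hv 0 0 fun ψ hψ => by
    rw [hdiv ψ hψ]; ring
  have hvV₀ : ∀ᵐ y ∂(volume.restrict (Ioo (-1 : ℝ) 1)), v y = V₀ y := by
    filter_upwards [hvae, ae_restrict_mem measurableSet_Ioo] with y hy hyI
    rw [hy, hV₀eq y ⟨hyI.1.le, hyI.2.le⟩, sub_zero]
  have hpi : IntegrableOn (fun y => v y * D y) (Ioo (-1) 1) :=
    integrableOn_Ioo_mul_continuous hv hDc
  have hqi : IntegrableOn (fun y => (u y * D y + v y * U' y) * (Complex.I * k)⁻¹)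
      (Ioo (-1) 1) :=
    Integrable.mul_const ((integrableOn_Ioo_mul_continuous hu hDc).add
      (integrableOn_Ioo_mul_continuous hv (Complex.continuous_ofReal.comp hU'c))) _
  obtain ⟨c, hc⟩ := exists_ae_eq_primitive_of_integral hpi hqi heq
  set S : ℝ → ℂ := fun y => ∫ t in (-1 : ℝ)..y, V₀ t * D t with hS
  have hSd : ∀ y, HasDerivAt S (V₀ y * D y) y := hprim (hV₀c.mul hDc)
  have hSc : Continuous S := continuous_iff_continuousAt.2 fun y => (hSd y).continuousAt
  -- The momentum equation integrates to `(uD + vU')/(ik) = S + c`. As `Re λ > 0` keeps `D` away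
  -- from zero, it can be solved for `u`, which thus has a continuous representative.
  set w : ℝ → ℂ := fun y => (Complex.I * k * (S y + c) - V₀ y * U' y) / D y with hw
  have hwc : Continuous w := Continuous.div (by fun_prop) hDc hne
  have huw : ∀ᵐ y ∂(volume.restrict (Ioo (-1 : ℝ) 1)), u y = w y := by
    filter_upwards [hc, hvV₀, ae_restrict_mem measurableSet_Ioo] with y h1 h2 hyI
    rw [hcongr (g := fun t => V₀ t * D t) (by filter_upwards [hvV₀] with t ht; rw [ht]) y
      hyI.2.le, hIoo _ _ hyI.1.le, h2] at h1
    rw [hw]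
    simp only [hS]
    rw [eq_div_iff (hne y), ← h1, mul_comm (Complex.I * (k : ℂ)), inv_mul_cancel_right₀ hIk]
    ring
  -- Integrating `w` instead of `u₀` gives a function that is `C¹` on all of `ℝ` and agrees with
  -- `V₀` on the channel.
  set V : ℝ → ℂ := fun y => ∫ t in (-1 : ℝ)..y, -(Complex.I * k) * w t with hV
  have hV'c : Continuous fun t => -(Complex.I * k) * w t := continuous_const.mul hwc
  have hVd : ∀ y, HasDerivAt V (-(Complex.I * k) * w y) y := hprim hV'c
  have hVV₀ : ∀ y ∈ Icc (-1 : ℝ) 1, V₀ y = V y := by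
    intro y hy
    rw [← hV₀eq y hy, hcongr (g := fun t => -(Complex.I * k) * w t)
      (by filter_upwards [huw] with t ht; rw [ht]) y hy.2, hIoo _ _ hy.1]
  have hV₀d : ∀ y ∈ Ioo (-1 : ℝ) 1, HasDerivAt V₀ (-(Complex.I * k) * w y) y := by
    intro y hy
    refine (hVd y).congr_of_eventuallyEq ?_
    filter_upwards [Ioo_mem_nhds hy.1 hy.2] with t ht using hVV₀ t ⟨ht.1.le, ht.2.le⟩
  have hzero := hmain U U' U'' V (fun t => -(Complex.I * k) * w t) k lam hU hU' hU''c hb' hb'' hhol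
    hVd hV'c (by simp [hV])
    (by rw [← hVV₀ 1 (by norm_num), ← hV₀eq 1 (by norm_num), hV₀1, add_zero]) hk hlam ?_
  · constructor
    · filter_upwards [huw, ae_restrict_mem measurableSet_Ioo] with y hy hyI
      have h0 : HasDerivAt V 0 y := by
        refine (hasDerivAt_const y (0 : ℂ)).congr_of_eventuallyEq ?_
        filter_upwards [Ioo_mem_nhds hyI.1 hyI.2] with t ht using hzero t ⟨ht.1.le, ht.2.le⟩
      have := (hVd y).unique h0
      rw [hy]
      exact (mul_eq_zero.1 this).resolve_left (neg_ne_zero.2 hIk)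
    · filter_upwards [hvV₀, ae_restrict_mem measurableSet_Ioo] with y hy hyI
      have hyI' : y ∈ Icc (-1 : ℝ) 1 := ⟨hyI.1.le, hyI.2.le⟩
      rw [hy, hVV₀ y hyI', hzero y hyI']
  · intro y hy
    have hDd : HasDerivAt D (Complex.I * k * U' y) y :=
      ((hU y).ofReal_comp.const_mul _).const_add _
    have hnum := (((hSd y).add_const c).const_mul (Complex.I * k)).sub
      ((hV₀d y hy).mul (hU' y).ofReal_comp)
    have hwd := (hnum.div hDd (hne y)).const_mul (-(Complex.I * (k : ℂ)))
    -- In the quotient rule the `U'` terms cancel because `V₀' = -ik w` and `D' = ik U'`; what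
    -- remains is the Rayleigh equation.
    refine hwd.congr_deriv ?_
    rw [← hVV₀ y ⟨hy.1.le, hy.2.le⟩]
    have hn : Complex.I * k * (S y + c) - V₀ y * U' y = w y * D y := by
      simp only [hw]; rw [div_mul_cancel₀ _ (hne y)]
    have hI := Complex.I_sq
    simp only [Pi.sub_apply, Pi.mul_apply]
    rw [hn, show lam + Complex.I * k * U y = D y from rfl]
    have := hne y
    field_simp
    linear_combination (-(k : ℂ) ^ 2 * D y * V₀ y) * hI

end Mode

/-! ### Fourier series in the periodic variable -/

section FourierReduction

lemma volume_restrict_cell (T : ℝ) : (volume : Measure (ℝ × ℝ)).restrict (cell T) =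
    ((volume : Measure ℝ).restrict (Ioc 0 T)).prod
      ((volume : Measure ℝ).restrict (Ioo (-1) 1)) := by
  rw [cell, Measure.prod_restrict, Measure.volume_eq_prod]

/-- The character `x ↦ exp (-i k x)`. -/
noncomputable def expMode (k x : ℝ) : ℂ := Complex.exp (-(Complex.I * k) * x)

lemma hasDerivAt_expMode (k x : ℝ) :
    HasDerivAt (expMode k) (-(Complex.I * k) * expMode k x) x := by
  have h1 : HasDerivAt (fun x : ℝ => -(Complex.I * k) * (x : ℂ)) (-(Complex.I * k)) x := by
    simpa [mul_comm] using (hasDerivAt_id x).ofReal_comp.const_mul (-(Complex.I * (k : ℂ)))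
  exact h1.cexp.congr_deriv (mul_comm _ _)

lemma contDiff_expMode (k : ℝ) : ContDiff ℝ ∞ (expMode k) :=
  (contDiff_const.mul Complex.ofRealCLM.contDiff).cexp

lemma norm_expMode (k x : ℝ) : ‖expMode k x‖ = 1 := by
  rw [expMode, Complex.norm_exp]
  simp

lemma expMode_add_period {T : ℝ} (hT : 0 < T) (n : ℤ) (x : ℝ) :
    expMode (2 * Real.pi * n / T) (x + T) = expMode (2 * Real.pi * n / T) x := by
  rw [expMode, expMode, Complex.exp_eq_exp_iff_exists_int]
  refine ⟨-n, ?_⟩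
  have : (T : ℂ) ≠ 0 := by exact_mod_cast hT.ne'
  push_cast
  field_simp
  ring

/-- The partial Fourier coefficient `y ↦ ∫₀ᵀ f(x,y) exp(-ikx) dx`. -/
noncomputable def partialFourier (T k : ℝ) (f : ℝ × ℝ → ℂ) (y : ℝ) : ℂ :=
  ∫ x in Ioc 0 T, f (x, y) * expMode k x

lemma integrable_mul_expMode {T : ℝ} (k : ℝ) {f : ℝ × ℝ → ℂ}
    (hf : IntegrableOn f (cell T)) : IntegrableOn (fun p => f p * expMode k p.1) (cell T) := by
  refine Integrable.mul_bdd (c := 1) hf ?_ (Filter.Eventually.of_forall fun p => ?_)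
  · exact ((contDiff_expMode k).continuous.comp continuous_fst).aestronglyMeasurable
  · rw [norm_expMode]

lemma integrableOn_partialFourier {T : ℝ} (k : ℝ) {f : ℝ × ℝ → ℂ}
    (hf : IntegrableOn f (cell T)) : IntegrableOn (partialFourier T k f) (Ioo (-1) 1) := by
  have h := integrable_mul_expMode k hf
  rw [IntegrableOn, volume_restrict_cell] at h
  exact h.integral_prod_right

lemma integrableOn_cell_mul_snd {T : ℝ} {f : ℝ × ℝ → ℂ} (hf : IntegrableOn f (cell T))
    {g : ℝ → ℂ} (hg : Continuous g) : IntegrableOn (fun p => f p * g p.2) (cell T) := by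
  obtain ⟨C, hC⟩ := (isCompact_Icc (a := (-1 : ℝ)) (b := 1)).exists_bound_of_continuousOn
    hg.continuousOn
  refine Integrable.mul_bdd (c := C) hf (hg.comp continuous_snd).aestronglyMeasurable ?_
  have hm : MeasurableSet (cell T) := measurableSet_Ioc.prod measurableSet_Ioo
  filter_upwards [ae_restrict_mem hm] with p hp
  exact hC p.2 ⟨hp.2.1.le, hp.2.2.le⟩

lemma integral_cell_mul_expMode {T : ℝ} (k : ℝ) {f : ℝ × ℝ → ℂ} (hf : IntegrableOn f (cell T))
    {g : ℝ → ℂ} (hg : Continuous g) :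
    ∫ p in cell T, f p * expMode k p.1 * g p.2 =
      ∫ y in Ioo (-1 : ℝ) 1, partialFourier T k f y * g y := by
  have h := integrableOn_cell_mul_snd (integrable_mul_expMode k hf) hg
  rw [IntegrableOn, volume_restrict_cell] at h
  rw [volume_restrict_cell, integral_prod_symm _ h]
  refine integral_congr_ae (Filter.Eventually.of_forall fun y => ?_)
  simp only [partialFourier]
  rw [integral_mul_const]

lemma integral_cell_add_mul_expMode {T : ℝ} (k : ℝ) {u v : ℝ × ℝ → ℂ}
    (hu : IntegrableOn u (cell T)) (hv : IntegrableOn v (cell T)) {g₁ g₂ : ℝ → ℂ}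
    (hg₁ : Continuous g₁) (hg₂ : Continuous g₂) :
    ∫ p in cell T, (u p * expMode k p.1 * g₁ p.2 + v p * expMode k p.1 * g₂ p.2) =
      ∫ y in Ioo (-1 : ℝ) 1,
        (partialFourier T k u y * g₁ y + partialFourier T k v y * g₂ y) := by
  rw [integral_add (integrableOn_cell_mul_snd (integrable_mul_expMode k hu) hg₁)
    (integrableOn_cell_mul_snd (integrable_mul_expMode k hv) hg₂),
    integral_cell_mul_expMode k hu hg₁, integral_cell_mul_expMode k hv hg₂, ← integral_add]
  · exact integrableOn_Ioo_mul_continuous (integrableOn_partialFourier k hu) hg₁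
  · exact integrableOn_Ioo_mul_continuous (integrableOn_partialFourier k hv) hg₂

/-- A square integrable function all of whose Fourier modes in `x` vanish is zero. -/
lemma ae_eq_zero_of_partialFourier {T : ℝ} (hT : 0 < T) {f : ℝ × ℝ → ℂ}
    (hf : MemLp f 2 (volume.restrict (cell T)))
    (h : ∀ n : ℤ, ∀ᵐ y ∂(volume.restrict (Ioo (-1 : ℝ) 1)),
      partialFourier T (2 * Real.pi * n / T) f y = 0) :
    f =ᵐ[volume.restrict (cell T)] 0 := by
  have hsq : Integrable (fun p => ‖f p‖ ^ 2) (volume.restrict (cell T)) :=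
    (memLp_two_iff_integrable_sq_norm hf.1).1 hf
  have hfm := hf.1
  rw [volume_restrict_cell] at hsq hfm ⊢
  have hmeas := hfm.prod_swap.prodMk_left
  have hzero : ∀ᵐ y ∂(volume.restrict (Ioo (-1 : ℝ) 1)),
      ∫ x in Ioc 0 T, ‖f (x, y)‖ ^ 2 = 0 := by
    filter_upwards [ae_all_iff.2 h, hsq.prod_left_ae, hmeas] with y hy hyI hym
    have hL2 : MemLp (fun x => f (x, y)) 2 (volume.restrict (Ioc 0 T)) :=
      (memLp_two_iff_integrable_sq_norm hym).2 hyI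
    -- Parseval on almost every horizontal line.
    have hsum := hasSum_sq_fourierCoeffOn hT hL2
    have hc : ∀ n : ℤ, fourierCoeffOn hT (fun x => f (x, y)) n = 0 := by
      intro n
      have e : ∀ x : ℝ, (fourier (-n) (x : AddCircle (T - 0)) : ℂ) • f (x, y) =
          f (x, y) * expMode (2 * Real.pi * n / T) x := by
        intro x
        rw [fourier_coe_apply, smul_eq_mul, mul_comm, expMode]
        congr 2
        push_cast
        rw [sub_zero]
        ring
      rw [fourierCoeffOn_eq_integral, intervalIntegral.integral_of_le hT.le]
      simp only [e]
      have := hy n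
      rw [partialFourier] at this
      rw [this, smul_zero]
    simp only [hc, norm_zero, ne_eq, OfNat.ofNat_ne_zero, not_false_eq_true, zero_pow] at hsum
    have h0 := hasSum_zero.unique hsum
    rw [intervalIntegral.integral_of_le hT.le, sub_zero, eq_comm, smul_eq_zero] at h0
    exact h0.resolve_left (inv_ne_zero hT.ne')
  have hint : ∫ p, ‖f p‖ ^ 2 ∂(((volume : Measure ℝ).restrict (Ioc 0 T)).prod
      ((volume : Measure ℝ).restrict (Ioo (-1) 1))) = 0 := by
    rw [integral_prod_symm _ hsq, integral_congr_ae hzero]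
    simp
  rw [integral_eq_zero_iff_of_nonneg (fun p => by positivity) hsq] at hint
  filter_upwards [hint] with p hp
  simpa using hp

lemma dx_dy_mul {e ψ : ℝ → ℂ} {e' ψ' : ℂ} {p : ℝ × ℝ} (he : HasDerivAt e e' p.1)
    (hψ : HasDerivAt ψ ψ' p.2) :
    dx (fun q => e q.1 * ψ q.2) p = e' * ψ p.2 ∧ dy (fun q => e q.1 * ψ q.2) p = e p.1 * ψ' := by
  have h1 : HasFDerivAt (fun q : ℝ × ℝ => e q.1) _ p := he.hasFDerivAt.comp p hasFDerivAt_fst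
  have h2 : HasFDerivAt (fun q : ℝ × ℝ => ψ q.2) _ p := hψ.hasFDerivAt.comp p hasFDerivAt_snd
  have h3 : fderiv ℝ (fun q : ℝ × ℝ => e q.1 * ψ q.2) p = _ := (h1.mul h2).fderiv
  constructor
  · rw [dx, h3]; simp [mul_comm]
  · rw [dy, h3]; simp

end FourierReduction

/-! ### From vanishing modes to stability -/

/-- `C^{2,α}` closeness of `U` to the Couette flow implies linear stability. -/
lemma isLinearlyStable_of_holder {α : ℝ} (hα : 0 < α) (hα1 : α ≤ 1 / 2) :
    ∃ δ : ℝ, 0 < δ ∧ δ ≤ 1 / 2 ∧ ∀ (T : ℝ) (W U U' U'' : ℝ → ℝ), 0 < T →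
      (∀ y ∈ Ioo (-1 : ℝ) 1, W y = U y) →
      (∀ y, HasDerivAt U (U' y) y) → (∀ y, HasDerivAt U' (U'' y) y) → Continuous U'' →
      (∀ y, |U' y - 1| ≤ δ) → (∀ y, |U'' y| ≤ δ) →
      (∀ x y, |U'' x - U'' y| ≤ δ * |x - y| ^ α) → IsLinearlyStable T W := by
  obtain ⟨δ, hδ, hδ1, hmain⟩ := mode_eq_zero hα hα1
  refine ⟨δ, hδ, hδ1, ?_⟩
  intro T W U U' U'' hT hWU hU hU' hU''c hb' hb'' hhol lam hlam
  by_contra hre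
  push Not at hre
  obtain ⟨u, v, hvel, hnz, hsol⟩ := hlam
  refine hnz ?_
  have hUc : Continuous U := continuous_iff_continuousAt.2 fun y => (hU y).continuousAt
  have hU'c : Continuous U' := continuous_iff_continuousAt.2 fun y => (hU' y).continuousAt
  have hW' : ∀ y ∈ Ioo (-1 : ℝ) 1, deriv W y = U' y := by
    intro y hy
    refine ((hU y).congr_of_eventuallyEq ?_).deriv
    filter_upwards [Ioo_mem_nhds hy.1 hy.2] with t ht using hWU t ht
  have hcm : MeasurableSet (cell T) := measurableSet_Ioc.prod measurableSet_Ioo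
  have : IsFiniteMeasure ((volume : Measure (ℝ × ℝ)).restrict (cell T)) := by
    rw [volume_restrict_cell]; infer_instance
  have hui : IntegrableOn u (cell T) := hvel.memLp_u.integrable one_le_two
  have hvi : IntegrableOn v (cell T) := hvel.memLp_v.integrable one_le_two
  have hd : ∀ {f : ℝ → ℂ}, ContDiff ℝ ∞ f → ∀ y, HasDerivAt f (deriv f y) y := fun hf y =>
    (hf.differentiable (by simp) y).hasDerivAt
  have hdc : ∀ {f : ℝ → ℂ}, ContDiff ℝ ∞ f → Continuous (deriv f) := fun hf =>
    hf.continuous_deriv (by simp)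
  have hds : ∀ {f : ℝ → ℂ}, ContDiff ℝ ∞ f → ContDiff ℝ ∞ (deriv f) := fun hf =>
    (contDiff_infty_iff_deriv.1 hf).2
  have hsmooth : ∀ (k : ℝ) {ψ : ℝ → ℂ}, ContDiff ℝ ∞ ψ →
      ContDiff ℝ ∞ (fun q : ℝ × ℝ => expMode k q.1 * ψ q.2) := fun k ψ hψ =>
    ((contDiff_expMode k).comp contDiff_fst).mul (hψ.comp contDiff_snd)
  have hper : ∀ (n : ℤ) (ψ : ℝ → ℂ),
      XPeriodic T (fun q : ℝ × ℝ => expMode (2 * Real.pi * n / T) q.1 * ψ q.2) := by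
    intro n ψ x y
    simp only [expMode_add_period hT]
  have hdiv : ∀ (n : ℤ) (ψ : ℝ → ℂ), ContDiff ℝ ∞ ψ → ∫ y in Ioo (-1 : ℝ) 1,
      (-(Complex.I * (2 * Real.pi * n / T : ℝ)) * partialFourier T (2 * Real.pi * n / T) u y * ψ y +
        partialFourier T (2 * Real.pi * n / T) v y * deriv ψ y) = 0 := by
    intro n ψ hψ
    set k : ℝ := 2 * Real.pi * n / T
    have h1 := hvel.div_free _ (hsmooth k hψ) (hper n ψ)
    rw [← h1]
    have h2 := integral_cell_add_mul_expMode k hui hvi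
      (g₁ := fun y => -(Complex.I * k) * ψ y) (g₂ := deriv ψ)
      (continuous_const.mul hψ.continuous) (hdc hψ)
    refine Eq.trans ?_ (h2.symm.trans ?_)
    · congr 1; funext y; ring
    · congr 1; funext p
      obtain ⟨e1, e2⟩ := dx_dy_mul (hasDerivAt_expMode k p.1) (hd hψ p.2)
      rw [e1, e2]; ring
  have hmode : ∀ n : ℤ, (∀ᵐ y ∂(volume.restrict (Ioo (-1 : ℝ) 1)),
      partialFourier T (2 * Real.pi * n / T) u y = 0) ∧
      ∀ᵐ y ∂(volume.restrict (Ioo (-1 : ℝ) 1)),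
        partialFourier T (2 * Real.pi * n / T) v y = 0 := by
    intro n
    have hu_int := integrableOn_partialFourier (2 * Real.pi * n / T) hui
    have hv_int := integrableOn_partialFourier (2 * Real.pi * n / T) hvi
    -- The mean in `x` escapes the Rayleigh equation. Incompressibility kills the mean of `v`; the
    -- shear test fields `(ψ', 0)` then give `λ ∫ u ψ' = 0`, and `λ ≠ 0` kills the mean of `u`.
    rcases eq_or_ne n 0 with rfl | hn
    · have hk : (2 * Real.pi * ((0 : ℤ) : ℝ) / T) = 0 := by simp
      have hv0 : ∀ᵐ y ∂(volume.restrict (Ioo (-1 : ℝ) 1)), partialFourier T 0 v y = 0 := by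
        have := (ae_eq_primitive_of_integral (p := fun _ => 0) integrableOn_zero hv_int 0 0
          fun ψ hψ => by
            have := hdiv 0 ψ hψ
            simpa using this).2
        rw [hk] at this
        filter_upwards [this] with y hy
        rw [hy]; simp
      refine ⟨?_, by rw [hk]; exact hv0⟩
      have := (ae_eq_primitive_of_integral (p := fun _ => 0) integrableOn_zero hu_int 0 0
        fun ψ hψ => ?_).2
      · filter_upwards [this] with y hy
        rw [hy]; simp
      · have htest : IsTestField T (fun q => expMode 0 q.1 * deriv ψ q.2) (fun _ => 0) := by
          refine ⟨hsmooth 0 (hds hψ), contDiff_const, by simpa using hper 0 (deriv ψ),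
            fun _ _ => rfl, fun p => ?_, fun x => ⟨rfl, rfl⟩⟩
          rw [(dx_dy_mul (hasDerivAt_expMode 0 p.1) (hd (hds hψ) p.2)).1]
          simp [dy]
        have h1 := hsol _ _ htest
        have h2 := integral_cell_add_mul_expMode 0 hui hvi
          (g₁ := fun y => lam * deriv ψ y) (g₂ := fun y => U' y * deriv ψ y)
          (continuous_const.mul (hdc hψ)) ((Complex.continuous_ofReal.comp hU'c).mul (hdc hψ))
        have h3 : ∫ y in Ioo (-1 : ℝ) 1, (partialFourier T 0 u y * (lam * deriv ψ y) +
            partialFourier T 0 v y * (U' y * deriv ψ y)) = 0 := by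
          rw [← h2, ← h1]
          refine setIntegral_congr_fun hcm fun p hp => ?_
          rw [(dx_dy_mul (hasDerivAt_expMode 0 p.1) (hd (hds hψ) p.2)).1, hW' p.2 hp.2]
          simp [dx]
          ring
        have h4 : lam * ∫ y in Ioo (-1 : ℝ) 1, partialFourier T 0 u y * deriv ψ y = 0 := by
          rw [← integral_const_mul, ← h3]
          refine integral_congr_ae ?_
          filter_upwards [hv0] with y hy
          rw [hy]; ring
        have hlam0 : lam ≠ 0 := by rintro rfl; simp at hre
        rw [hk]
        simpa using (mul_eq_zero.1 h4).resolve_left hlam0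
    · have hk : (2 * Real.pi * n / T) ≠ 0 := by
        have : (n : ℝ) ≠ 0 := by exact_mod_cast hn
        positivity
      refine hmain U U' U'' _ _ (2 * Real.pi * n / T) lam hU hU' hU''c hb' hb'' hhol hu_int hv_int hk
        hre (hdiv n) fun ψ hψ hψm hψp => ?_
      set k : ℝ := 2 * Real.pi * n / T with hkdef
      have hIk : Complex.I * (k : ℂ) ≠ 0 :=
        mul_ne_zero Complex.I_ne_zero (by exact_mod_cast hk)
      have hAs : ContDiff ℝ ∞ fun y => (Complex.I * (k : ℂ))⁻¹ * deriv ψ y :=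
        contDiff_const.mul (hds hψ)
      -- The factor `(ik)⁻¹` makes the field divergence free, and `ψ(±1) = 0` makes it tangent to
      -- the walls.
      have htest : IsTestField T (fun q => expMode k q.1 * ((Complex.I * (k : ℂ))⁻¹ * deriv ψ q.2))
          (fun q => expMode k q.1 * ψ q.2) := by
        refine ⟨hsmooth k hAs, hsmooth k hψ, hper n (fun y => (Complex.I * (k : ℂ))⁻¹ * deriv ψ y),
          hper n ψ, fun p => ?_, fun x => ⟨by simp [hψm], by simp [hψp]⟩⟩
        rw [(dx_dy_mul (ψ := fun y => (Complex.I * (k : ℂ))⁻¹ * deriv ψ y)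
          (hasDerivAt_expMode k p.1) (hd hAs p.2)).1,
          (dx_dy_mul (hasDerivAt_expMode k p.1) (hd hψ p.2)).2]
        linear_combination (-(expMode k p.1 * deriv ψ p.2)) * mul_inv_cancel₀ hIk
      have h1 := hsol _ _ htest
      have hUcc : Continuous fun y => (U y : ℂ) := Complex.continuous_ofReal.comp hUc
      have hU'cc : Continuous fun y => (U' y : ℂ) := Complex.continuous_ofReal.comp hU'c
      have hψc := hψ.continuous
      have hψ'c := hdc hψ
      have h2 := integral_cell_add_mul_expMode k hui hvi
        (g₁ := fun y => (lam + Complex.I * k * U y) * ((Complex.I * (k : ℂ))⁻¹ * deriv ψ y))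
        (g₂ := fun y => (lam + Complex.I * k * U y) * ψ y +
          U' y * ((Complex.I * (k : ℂ))⁻¹ * deriv ψ y)) (by fun_prop) (by fun_prop)
      rw [← h1]
      refine Eq.trans ?_ (h2.symm.trans ?_)
      · congr 1; funext y; ring
      · refine setIntegral_congr_fun hcm fun p hp => ?_
        rw [(dx_dy_mul (ψ := fun y => (Complex.I * (k : ℂ))⁻¹ * deriv ψ y)
          (hasDerivAt_expMode k p.1) (hd hAs p.2)).1,
          (dx_dy_mul (hasDerivAt_expMode k p.1) (hd hψ p.2)).1, hW' p.2 hp.2, hWU p.2 hp.2]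
        ring
  exact ⟨ae_eq_zero_of_partialFourier hT hvel.memLp_u fun n => (hmode n).1,
    ae_eq_zero_of_partialFourier hT hvel.memLp_v fun n => (hmode n).2⟩

/-- A function differentiable on `(-1,1)` whose derivative agrees a.e. with a continuous function
is a primitive of that function. -/
lemma eq_primitive_of_deriv_ae_eq {W g : ℝ → ℝ} (hW : DifferentiableOn ℝ W (Ioo (-1) 1))
    (hg : Continuous g) (h : ∀ᵐ y ∂(volume.restrict (Ioo (-1 : ℝ) 1)), deriv W y = g y)
    {y : ℝ} (hy : y ∈ Ioo (-1 : ℝ) 1) : W y = W 0 + ∫ t in (0 : ℝ)..y, g t := by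
  have hsub : uIcc 0 y ⊆ Ioo (-1 : ℝ) 1 := by
    rw [uIcc_eq_union]
    rintro t (ht | ht)
    · exact ⟨by linarith [ht.1], ht.2.trans_lt hy.2⟩
    · exact ⟨hy.1.trans_le ht.1, by linarith [ht.2]⟩
  have hae : ∀ᵐ t ∂(volume.restrict (uIoc 0 y)), deriv W t = g t :=
    ae_restrict_of_ae_restrict_of_subset (uIoc_subset_uIcc.trans hsub) h
  -- `W` is only differentiable; integrability of its derivative, needed for the fundamental
  -- theorem, comes from `g`.
  have hi : IntervalIntegrable (deriv W) volume 0 y :=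
    (hg.intervalIntegrable 0 y).congr_ae (by filter_upwards [hae] with t ht using ht.symm)
  have h1 := intervalIntegral.integral_eq_sub_of_hasDerivAt (fun t ht =>
    ((hW t (hsub ht)).differentiableAt (Ioo_mem_nhds (hsub ht).1 (hsub ht).2)).hasDerivAt) hi
  have h2 : ∫ t in (0 : ℝ)..y, deriv W t = ∫ t in (0 : ℝ)..y, g t :=
    intervalIntegral.integral_congr_ae_restrict hae
  linarith

lemma continuous_of_abs_sub_le_rpow {g : ℝ → ℝ} {M α : ℝ} (hα : 0 < α)
    (h : ∀ x y, |g x - g y| ≤ M * |x - y| ^ α) : Continuous g := by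
  refine continuous_iff_continuousAt.2 fun y => ?_
  rw [ContinuousAt, tendsto_iff_dist_tendsto_zero]
  refine squeeze_zero (fun _ => dist_nonneg) (fun x => (h x y)) ?_
  have hc : Continuous fun x : ℝ => M * |x - y| ^ α :=
    continuous_const.mul ((by fun_prop : Continuous fun x : ℝ => |x - y|).rpow_const
      fun _ => Or.inr hα.le)
  have := hc.tendsto y
  simpa [Real.zero_rpow hα.ne'] using this

end ShearFlow

theorem corollary4 (T : ℝ) (hT : 0 < T) (s : ℝ) (hs : 3 / 2 < s) :
    ∃ ε₀ : ℝ, 0 < ε₀ ∧ ∀ U : ℝ → ℝ, DifferentiableOn ℝ U (Ioo (-1) 1) →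
      ShearFlow.sobolevNorm s (fun y => deriv U y - 1) ≤ ENNReal.ofReal ε₀ →
        ShearFlow.IsLinearlyStable T U := by
  -- Below `s - 3/2` for the embedding, and at most `1/2` because `V` is only controlled in
  -- `C^{1/2}`.
  set α : ℝ := min (1 / 2) ((s - 3 / 2) / 2) with hαdef
  have hα : 0 < α := lt_min (by norm_num) (by linarith)
  have hα1 : α ≤ 1 / 2 := min_le_left _ _
  have hαs : α < s - 3 / 2 := (min_le_right _ _).trans_lt (by linarith)
  obtain ⟨δ, hδ, -, hstable⟩ := ShearFlow.isLinearlyStable_of_holder hα hα1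
  obtain ⟨C, hC, hemb⟩ :=
    ShearFlow.exists_hasDerivAt_holder_of_sobolevNorm_le hα (by linarith) hαs
  refine ⟨δ / C, by positivity, fun U hU hnorm => ?_⟩
  obtain ⟨G, G', hae, hG, hGb, hG'b, hG'h⟩ := hemb _ (δ / C) (by positivity) hnorm
  have hCδ : C * (δ / C) = δ := by field_simp
  rw [hCδ] at hGb hG'b hG'h
  have hGc : Continuous G := continuous_iff_continuousAt.2 fun y => (hG y).continuousAt
  have hgc : Continuous fun y => G y + 1 := by fun_prop
  -- The profile is replaced by a `C²` extension to the whole line that equals it on the open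
  -- channel and satisfies the bounds globally.
  refine hstable T U (fun y => U 0 + ∫ t in (0 : ℝ)..y, (G t + 1)) (fun y => G y + 1) G' hT
    (fun y hy => ShearFlow.eq_primitive_of_deriv_ae_eq hU hgc ?_ hy) (fun y => ?_)
    (fun y => (hG y).add_const 1) (ShearFlow.continuous_of_abs_sub_le_rpow hα hG'h)
    (fun y => by simpa using hGb y) hG'b hG'h
  · filter_upwards [hae] with t ht
    linarith
  · exact (intervalIntegral.integral_hasDerivAt_right (hgc.intervalIntegrable _ _)
      (hgc.stronglyMeasurableAtFilter _ _) hgc.continuousAt).const_add _
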